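/- The Shannon game $(G,s,t)$ is played on a finite simple graph $G$ with two distinct vertices $s,t$, the terminals. Two players, Short and Cut, alternately colour an uncoloured non-terminal vertex in their own colour until every non-terminal vertex is coloured; Short wins if $G$ has a path from $s$ to $t$ all of whose inner vertices have Short's colour, and otherwise Cut wins. Regarded as a link, $(G,s,t)$ is *strong* if Short has a winning strategy as second player, and *weak* if each player has a winning strategy when moving first. A weak link is *minimal* if deleting any single edge of $G$ (keeping all vertices) gives a game that is neither a weak nor a strong link. The *weight* $w$ is the number of non-terminal vertices. Let $d_s,d_t$ be the degrees of the terminals and $d_{\max}$ the maximum degree of $G$. **Theorem.** Every minimal weak link of weight $w>5$ whose graph is connected satisfies $$d_{\max}+\min(d_s,d_t)\le w-1,$$ with exactly one exception, up to isomorphism (preserving the unordered pair of terminals). The exception is the link on the nine vertices $s,t,a_1,a_2,c,v,c_1,c_2,u$ (so $w=7$) with terminals $s,t$ and the eleven edges $$sa_1,\ sa_2,\ a_1c,\ a_2c,\ cv,\ vt,\ cc_1,\ cc_2,\ c_1u,\ c_2u,\ ut;$$ it is a connected minimal weak link and it violates the inequality. -/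

import Mathlib

universe u

/-- The Shannon game `(G, s, t)`: a simple graph with two distinguished vertices, the terminals.
Regarded as a link, it is a link between `s` and `t`. -/
structure ShannonGame (V : Type u) where
  graph : SimpleGraph V
  s : V
  t : V
  s_ne_t : s ≠ t

namespace ShannonGame

/-- The two players. They alternately colour one uncoloured non-terminal vertex in their own
colour, until every non-terminal vertex is coloured. -/
inductive Player : Type
  | short : Player
  | cut : Player

/-- A position: the vertices coloured so far by Short and by Cut. -/
structure Position (V : Type u) where
  short : Finset V
  cut : Finset V

variable {V : Type u}

/-- The player moving after `P`. -/
def Player.other : Player → Player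
  | Player.short => Player.cut
  | Player.cut => Player.short

/-- The position before the first move. -/
def Position.initial : Position V := ⟨∅, ∅⟩

/-- The position after player `P` has coloured the vertex `v`. -/
def Position.play [DecidableEq V] (p : Position V) : Player → V → Position V
  | Player.short, v => ⟨insert v p.short, p.cut⟩
  | Player.cut, v => ⟨p.short, insert v p.cut⟩

/-- The vertex `v` may still be coloured: it is neither a terminal nor already coloured. -/
def Free (L : ShannonGame V) (p : Position V) (v : V) : Prop :=
  v ≠ L.s ∧ v ≠ L.t ∧ v ∉ p.short ∧ v ∉ p.cut

/-- Short has joined the terminals by a path all of whose inner vertices are coloured by Short. -/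
def ShortConnects (L : ShannonGame V) (p : Position V) : Prop :=
  ∃ γ : L.graph.Walk L.s L.t, γ.IsPath ∧ ∀ v ∈ γ.support, v = L.s ∨ v = L.t ∨ v ∈ p.short

/-- The player who has won at a position where all non-terminal vertices are coloured: Short if
he has joined the terminals, Cut otherwise. -/
def WonBy (L : ShannonGame V) (p : Position V) : Player → Prop
  | Player.short => L.ShortConnects p
  | Player.cut => ¬ L.ShortConnects p

/-- `L.HasWinningStrategy P Q p`: player `P` has a winning strategy from the position `p` when
player `Q` is to move. Either the game is over and `P` has won, or `P` is to move and has a move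
after which he has a winning strategy, or his opponent is to move and `P` has a winning strategy
after each move of the opponent. -/
inductive HasWinningStrategy [DecidableEq V] (L : ShannonGame V) (P : Player) :
    Player → Position V → Prop
  | finished (Q : Player) (p : Position V) (hend : ∀ v, ¬ L.Free p v) (hwon : L.WonBy p P) :
      HasWinningStrategy L P Q p
  | ownMove (p : Position V) (v : V) (hv : L.Free p v)
      (h : HasWinningStrategy L P P.other (p.play P v)) : HasWinningStrategy L P P p
  | opponentMove (p : Position V) (hfree : ∃ v, L.Free p v)
      (h : ∀ v, L.Free p v → HasWinningStrategy L P P (p.play P.other v)) :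
      HasWinningStrategy L P P.other p

/-- `P` has a winning strategy when moving first. -/
def WinsFirst [DecidableEq V] (L : ShannonGame V) (P : Player) : Prop :=
  L.HasWinningStrategy P P Position.initial

/-- `P` has a winning strategy when moving second. -/
def WinsSecond [DecidableEq V] (L : ShannonGame V) (P : Player) : Prop :=
  L.HasWinningStrategy P P.other Position.initial

/-- A strong link: Short has a second-player winning strategy. -/
def IsStrongLink [DecidableEq V] (L : ShannonGame V) : Prop :=
  L.WinsSecond Player.short

/-- A weak link: both players have a first-player winning strategy. -/
def IsWeakLink [DecidableEq V] (L : ShannonGame V) : Prop :=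
  L.WinsFirst Player.short ∧ L.WinsFirst Player.cut

/-- The game obtained by deleting the edge `e` (all vertices are kept). -/
def deleteEdge (L : ShannonGame V) (e : Sym2 V) : ShannonGame V where
  graph := L.graph.deleteEdges {e}
  s := L.s
  t := L.t
  s_ne_t := L.s_ne_t

/-- A minimal weak link: a weak link that is weakened by the deletion of any single edge, which
means that the result is no longer a link, neither weak nor strong. -/
def IsMinimalWeakLink [DecidableEq V] (L : ShannonGame V) : Prop :=
  L.IsWeakLink ∧
    ∀ e ∈ L.graph.edgeSet, ¬ (L.deleteEdge e).IsWeakLink ∧ ¬ (L.deleteEdge e).IsStrongLink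

/-- The weight: the number of vertices, excluding the terminals. -/
def weight [Fintype V] [DecidableEq V] (L : ShannonGame V) : ℕ :=
  (Finset.univ.filter fun v => v ≠ L.s ∧ v ≠ L.t).card

/-- The inequality `d_max + min (d_s, d_t) ≤ w - 1`. -/
def DegreeBound [Fintype V] [DecidableEq V] (L : ShannonGame V) [DecidableRel L.graph.Adj] :
    Prop :=
  L.graph.maxDegree + min (L.graph.degree L.s) (L.graph.degree L.t) ≤ L.weight - 1

/-- Two links are the same up to isomorphism: a graph isomorphism carries the (unordered) pair of
terminals of one to that of the other. -/
def Isomorphic {W : Type*} (L : ShannonGame V) (M : ShannonGame W) : Prop :=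
  ∃ φ : L.graph ≃g M.graph, (φ L.s = M.s ∧ φ L.t = M.t) ∨ (φ L.s = M.t ∧ φ L.t = M.s)

/-- The edges of the exceptional link. The terminals are `0` and `1`. Terminal `0` is joined
through the bridge `{2, 3}` to the vertex `4`; the vertex `4` is joined to `1` by the path
`4, 5, 1`, and through the bridge `{6, 7}` to the vertex `8`, which is adjacent to `1`. -/
def exceptionalEdges : Finset (Sym2 (Fin 9)) :=
  {s(0, 2), s(0, 3), s(2, 4), s(3, 4), s(4, 5), s(5, 1), s(4, 6), s(4, 7), s(6, 8), s(7, 8),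
    s(8, 1)}

/-- The exceptional link. -/
def exceptionalLink : ShannonGame (Fin 9) where
  graph := SimpleGraph.fromEdgeSet (exceptionalEdges : Set (Sym2 (Fin 9)))
  s := 0
  t := 1
  s_ne_t := by decide

instance decidableRelExceptionalLink : DecidableRel exceptionalLink.graph.Adj := fun a b =>
  decidable_of_iff (s(a, b) ∈ exceptionalEdges ∧ a ≠ b)
    (by simp [exceptionalLink, SimpleGraph.fromEdgeSet_adj])

end ShannonGame

/-! By determinacy, a game in which Short wins moving first is a weak or a strong link. Minimality
therefore gives `EdgeMinimal`: Short wins moving first, but no longer after the deletion of any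
edge. Fix a winning first move `m`. Two kinds of restriction follow.

Local: no edge may be dispensable once Short owns `m`. Hence the neighbours of a terminal are
independent, so are those of `m`, every inner vertex has two neighbours, and `m` has three.

Global: if Short wins using only edges among at most seven vertices, then, as `w > 5`, some vertex
lies outside, and by connectedness it carries an edge that could be deleted (`false_of_small`). So
small winning patterns cannot occur; for example, the terminals have no common neighbour, and two
neighbours of `s` have no common neighbour adjacent to `t`.

Suppose that `d_x + min (d_s, d_t) ≥ w`. Counting neighbourhoods excludes terminals at once. For `x`
adjacent to a terminal it makes both terminal degrees at most 2 and the neighbourhoods of `x`, `s`,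
`t` cover everything; `false_of_adj_terminal` refutes this by cases on the place of `m`. Otherwise,
up to exchanging terminals, `x` and `t` have exactly one common neighbour `b`, their neighbourhoods
cover all other inner vertices, and `x` is adjacent to all neighbours of `s`. Again by cases on `m`,
`containsExceptional_of_not_adj_terminal` finds the exceptional link inside `G`. The main case is `m
= x`: Cut answers `b`, and unless the exceptional link is present he wins by pairing or by a double
necessity. Since Short already wins on the exceptional link, minimality and connectedness leave no
room for further edges or vertices. That this link is itself minimal is shown by explicit vertex
cuts after each deletion. -/

namespace ShannonGame

/-! ### Abstract Maker-Breaker strategies for a winning condition on sets of vertices -/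

section Forcing

variable {V : Type u} [DecidableEq V]

/-- Short owns `A`, the vertices of `F` are uncoloured, and Cut is to move: Short can reach a set
satisfying `W`. -/
inductive Forces (W : Finset V → Prop) : Finset V → Finset V → Prop
  | done (A F : Finset V) (h : W A) : Forces W A F
  | reply (A F : Finset V) (ρ : V → V) (hF : F.Nonempty) (hρ : ∀ c ∈ F, ρ c ∈ F ∧ ρ c ≠ c)
      (h : ∀ c ∈ F, Forces W (insert (ρ c) A) ((F.erase c).erase (ρ c))) : Forces W A F

/-- The same with Short to move. -/
def ForcesFirst (W : Finset V → Prop) (A F : Finset V) : Prop :=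
  W A ∨ ∃ r ∈ F, Forces W (insert r A) (F.erase r)

variable {W W' : Finset V → Prop} {A A' F F' : Finset V}

/-- The constructor takes the replies as one function `ρ`, so that `Forces` is not nested inside an
existential quantifier; choice recovers the usual form. -/
theorem Forces.of_reply (hF : F.Nonempty)
    (h : ∀ c ∈ F, ∃ r ∈ F, r ≠ c ∧ Forces W (insert r A) ((F.erase c).erase r)) :
    Forces W A F := by
  choose! ρ h1 h2 h3 using h
  exact .reply A F ρ hF (fun c hc => ⟨h1 c hc, h2 c hc⟩) h3

theorem Forces.after_cut (h : Forces W A F) {c : V} (hc : c ∈ F) :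
    ForcesFirst W A (F.erase c) := by
  cases h with
  | done _ _ h => exact .inl h
  | reply _ _ ρ hF hρ h =>
    exact .inr ⟨ρ c, Finset.mem_erase.2 ⟨(hρ c hc).2, (hρ c hc).1⟩, h c hc⟩

theorem Forces.win_all (hW : Monotone W) (h : Forces W A F) : W (A ∪ F) := by
  induction h with
  | done A F h => exact hW Finset.subset_union_left h
  | reply A F ρ hF hρ _ ih =>
    obtain ⟨c, hc⟩ := hF
    refine hW ?_ (ih c hc)
    have := (hρ c hc).1
    intro v hv
    simp only [Finset.mem_union, Finset.mem_insert, Finset.mem_erase] at hv ⊢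
    grind

theorem ForcesFirst.win_all (hW : Monotone W) (h : ForcesFirst W A F) : W (A ∪ F) := by
  obtain h | ⟨r, hr, h⟩ := h
  · exact hW Finset.subset_union_left h
  · refine hW ?_ (h.win_all hW)
    intro v hv
    simp only [Finset.mem_union, Finset.mem_insert, Finset.mem_erase] at hv ⊢
    grind

theorem Forces.imp (h : Forces W A F) (hW : ∀ B, A ⊆ B → B ⊆ A ∪ F → W B → W' B) :
    Forces W' A F := by
  induction h with
  | done A F h => exact .done A F (hW A subset_rfl Finset.subset_union_left h)
  | reply A F ρ hF hρ _ ih =>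
    refine .reply A F ρ hF hρ fun c hc => ih c hc fun B h1 h2 => hW B ?_ ?_
    · exact (Finset.subset_insert _ _).trans h1
    · intro v hv
      have := h2 hv
      have := (hρ c hc).1
      simp only [Finset.mem_union, Finset.mem_insert, Finset.mem_erase] at *
      grind

/-- A vertex of Short that is irrelevant for winning may be given up. -/
theorem Forces.erase {m : V} (h : Forces W A F) (hm : m ∉ F) (hW : ∀ B, W B → W' (B.erase m)) :
    Forces W' (A.erase m) F := by
  induction h with
  | done A F h => exact .done _ F (hW A h)
  | reply A F ρ hF hρ _ ih =>
    refine .reply _ F ρ hF hρ fun c hc => ?_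
    have h1 := ih c hc (by simp [hm])
    rwa [Finset.erase_insert_of_ne] at h1
    rintro rfl
    exact hm (hρ c hc).1

/-- Neither additional vertices of Short nor additional uncoloured vertices harm Short. -/
theorem Forces.mono (hW : Monotone W) (hW' : ∀ B, A' ⊆ B → W B → W' B) (h : Forces W A F)
    (hA : A ⊆ A') (hF : F ⊆ F' ∪ A') : Forces W' A' F' := by
  induction hn : F'.card using Nat.strong_induction_on generalizing A A' F F' with
  | _ n ih =>
  subst hn
  by_cases hwin : W' A'
  · exact .done _ _ hwin
  have hall : ∀ B, W B → ∃ v ∈ B, v ∉ A' := by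
    intro B hB
    by_contra! hcon
    exact hwin (hW' A' subset_rfl (hW hcon hB))
  -- Short has a move to spare, because Cut's move `c` lies outside the strategy's board `G` or the
  -- prescribed reply is already his. He then takes any vertex of `G` that he lacks and keeps the
  -- strategic state `(B, G)`; such a vertex exists since owning `B ∪ G` wins.
  have other : ∀ c B G, B ⊆ A' → Forces W B G → c ∉ G → G ⊆ F' ∪ A' →
      ∃ r ∈ F', r ≠ c ∧ Forces W' (insert r A') ((F'.erase c).erase r) := by
    intro c B G hB hG hc hGF
    obtain ⟨r, hr, hrA⟩ := hall _ (hG.win_all hW)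
    have hrG : r ∈ G := (Finset.mem_union.1 hr).resolve_left fun h => hrA (hB h)
    have hrF : r ∈ F' := (Finset.mem_union.1 (hGF hrG)).resolve_right hrA
    have hrc : r ≠ c := fun h => hc (h ▸ hrG)
    refine ⟨r, hrF, hrc, ih _ ?_ (fun D hD => hW' D ((Finset.subset_insert _ _).trans hD)) hG
      (hB.trans (Finset.subset_insert _ _)) ?_ rfl⟩
    · exact (Finset.card_le_card (Finset.erase_subset_erase _ (Finset.erase_subset _ _))).trans_lt
        (Finset.card_erase_lt_of_mem hrF)
    · intro v hv
      have := hGF hv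
      simp only [Finset.mem_union, Finset.mem_insert, Finset.mem_erase] at *
      grind
  refine .of_reply ?_ fun c hc => ?_
  · obtain ⟨r, hr, hrA⟩ := hall _ (h.win_all hW)
    exact ⟨r, (Finset.mem_union.1 (hF ((Finset.mem_union.1 hr).resolve_left fun h => hrA (hA h)))
      ).resolve_right hrA⟩
  · by_cases hcF : c ∈ F
    · cases h with
      | done _ _ h => exact (hwin (hW' A' subset_rfl (hW hA h))).elim
      | reply _ _ ρ hF0 hρ h =>
        by_cases hr : ρ c ∈ A'
        · refine other c _ _ ?_ (h c hcF) (by simp) ?_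
          · exact Finset.insert_subset hr hA
          · exact ((Finset.erase_subset _ _).trans (Finset.erase_subset _ _)).trans hF
        · have hrF : ρ c ∈ F' := (Finset.mem_union.1 (hF (hρ c hcF).1)).resolve_right hr
          refine ⟨ρ c, hrF, (hρ c hcF).2, ih _ ?_
            (fun D hD => hW' D ((Finset.subset_insert _ _).trans hD)) (h c hcF)
            (Finset.insert_subset_insert _ hA) ?_ rfl⟩
          · exact (Finset.card_le_card (Finset.erase_subset_erase _
              (Finset.erase_subset _ _))).trans_lt (Finset.card_erase_lt_of_mem hrF)
          · intro v hv
            have := @hF v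
            simp only [Finset.mem_union, Finset.mem_insert, Finset.mem_erase] at *
            grind
    · exact other c A F hA h hcF hF

/-- An extra move never hurts: Short colours anything and then follows his second-player strategy.
-/
theorem Forces.forcesFirst (hW : Monotone W)
    (h : Forces W A F) : ForcesFirst W A F := by
  by_cases hw : W A
  · exact .inl hw
  cases h with
  | done _ _ h => exact .inl h
  | reply _ _ ρ hF hρ h =>
    obtain ⟨c, hc⟩ := hF
    exact .inr ⟨c, hc, (Forces.reply A F ρ ⟨c, hc⟩ hρ h).mono hW (fun _ _ h => h)
      (Finset.subset_insert _ _) (by grind)⟩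

/-- Short answers `y` by `u` and everything else by `y`. -/
theorem Forces.threat {y u : V} (hy : W (insert y A)) (hu : Forces W (insert u A) F)
    (hyu : y ≠ u) (hyF : y ∉ F) (huF : u ∉ F) : Forces W A (insert y (insert u F)) := by
  refine .of_reply ⟨y, by simp⟩ fun c hc => ?_
  by_cases hcy : c = y
  · subst hcy
    refine ⟨u, by simp, hyu.symm, ?_⟩
    convert hu using 1
    ext v
    simp only [Finset.mem_insert, Finset.mem_erase]
    grind
  · exact ⟨y, by simp, Ne.symm hcy, .done _ _ hy⟩

/-- Two winning strategies on disjoint sets of uncoloured vertices can be followed together. -/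
theorem Forces.and {W₁ W₂ : Finset V → Prop} (h₁ : Monotone W₁) (h₂ : Monotone W₂)
    {A₁ A₂ F₁ F₂ : Finset V} (hf₁ : Forces W₁ A₁ F₁) (hf₂ : Forces W₂ A₂ F₂)
    (hA₁ : A₁ ⊆ A) (hA₂ : A₂ ⊆ A) (hF : Disjoint F₁ F₂) :
    Forces (fun B => W₁ B ∧ W₂ B) A (F₁ ∪ F₂) := by
  induction hf₁ generalizing A A₂ F₂ with
  | done A₁ F₁ h =>
    exact hf₂.mono h₂ (fun B hB hw => ⟨h₁ (hA₁.trans hB) h, hw⟩) hA₂ (by grind)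
  | reply A₁ F₁ ρ hne hρ h ih =>
    induction hf₂ generalizing A with
    | done A₂ F₂ h' =>
      exact (Forces.reply A₁ F₁ ρ hne hρ h).mono h₁
        (fun B hB hw => ⟨hw, h₂ (hA₂.trans hB) h'⟩) hA₁ (by grind)
    | reply A₂ F₂ ρ' hne' hρ' h' ih' =>
      refine .of_reply (hne.mono Finset.subset_union_left) fun c hc => ?_
      rw [Finset.disjoint_left] at hF
      obtain hc | hc := Finset.mem_union.1 hc
      · refine ⟨ρ c, Finset.mem_union_left _ (hρ c hc).1, (hρ c hc).2, ?_⟩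
        have h3 := ih c hc (A := insert (ρ c) A) (.reply A₂ F₂ ρ' hne' hρ' h')
          (Finset.insert_subset_insert _ hA₁) (hA₂.trans (Finset.subset_insert _ _)) (by
            rw [Finset.disjoint_left]
            intro v hv
            simp only [Finset.mem_erase] at hv
            exact hF hv.2.2)
        convert h3 using 1
        ext v
        have := @hF c hc
        have := hF (hρ c hc).1
        simp only [Finset.mem_union, Finset.mem_erase]
        grind
      · refine ⟨ρ' c, Finset.mem_union_right _ (hρ' c hc).1, (hρ' c hc).2, ?_⟩
        have h3 := ih' c hc (A := insert (ρ' c) A) (hA₁.trans (Finset.subset_insert _ _))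
          (Finset.insert_subset_insert _ hA₂) (by
            rw [Finset.disjoint_left]
            intro v hv hv'
            simp only [Finset.mem_erase] at hv'
            exact hF hv hv'.2.2)
        convert h3 using 1
        ext v
        have := fun h => @hF c h hc
        have := fun h => @hF _ h (hρ' c hc).1
        simp only [Finset.mem_union, Finset.mem_erase]
        grind

theorem forces_pair {p q : V} (hpq : p ≠ q) :
    Forces (fun B => p ∈ B ∨ q ∈ B) A {p, q} :=
  Forces.threat (F := ∅) (by simp) (.done _ _ (by simp)) hpq (by simp) (by simp)

omit [DecidableEq V] in
theorem monotone_pair (p q : V) : Monotone fun B : Finset V => p ∈ B ∨ q ∈ B :=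
  fun _ _ h => Or.imp (@h p) (@h q)

/-- Short threatens `b`. If Cut takes it, Short takes `u` and is left with the pair `z, z'`. -/
theorem Forces.pair_threat {b u z z' : V} (hn : [b, u, z, z'].Nodup) :
    Forces (fun B => b ∈ B ∨ u ∈ B ∧ (z ∈ B ∨ z' ∈ B)) A {b, u, z, z'} := by
  simp only [List.nodup_cons, List.mem_cons, not_or, List.not_mem_nil] at hn
  refine Forces.threat (F := {z, z'}) (by simp) ?_ (by grind) (by grind) (by grind)
  exact Forces.threat (F := ∅) (by simp) (.done _ _ (by simp)) (by grind) (by simp) (by simp)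

omit [DecidableEq V] in
theorem monotone_pair_threat (b u z z' : V) :
    Monotone fun B : Finset V => b ∈ B ∨ u ∈ B ∧ (z ∈ B ∨ z' ∈ B) :=
  fun _ _ h => Or.imp (@h b) (And.imp (@h u) (Or.imp (@h z) (@h z')))

/-- If Short needs two vertices that he does not have, Cut wins as second player. -/
theorem not_forcesFirst_of_two {p q : V} (hW : Monotone W) (hp : p ∉ A) (hq : q ∉ A) (hpq : p ≠ q)
    (h : ∀ B, A ⊆ B → B ⊆ A ∪ F → W B → p ∈ B ∧ q ∈ B) : ¬ ForcesFirst W A F := by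
  -- If Short's move is not the needed vertex `x`, Cut takes `x`. Short's single move cannot be both
  -- `p` and `q`.
  have key : ∀ x y : V, x ∉ A → x ≠ y → (∀ B, A ⊆ B → B ⊆ A ∪ F → W B → x ∈ B ∧ y ∈ B) →
      ∀ r ∈ F, r ≠ x → ¬ Forces W (insert r A) (F.erase r) := by
    intro x y hx hxy hB r hr hrx hf
    have hxF : x ∈ F := by
      have := (hB _ (by grind) (by grind) (hf.win_all hW)).1
      simp only [Finset.mem_union, Finset.mem_insert, Finset.mem_erase] at this
      grind
    have := (hf.after_cut (c := x) (by grind)).win_all hW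
    have := (hB _ (by grind) (by grind) this).1
    grind
  rintro (hA | ⟨r, hr, hf⟩)
  · exact hp (h A subset_rfl Finset.subset_union_left hA).1
  · by_cases hrp : r = p
    · exact key q p hq hpq.symm (fun B h1 h2 h3 => (h B h1 h2 h3).symm) r hr (hrp ▸ hpq) hf
    · exact key p q hp hpq h r hr hrp hf

/-- If every winning set contains a pair `Q d y`, where `Q` is a matching, Cut wins as second
player by pairing. -/
theorem not_forcesFirst_of_matching (hW : Monotone W) {Q : V → V → Prop}
    (hleft : ∀ d y y', Q d y → Q d y' → y = y') (hright : ∀ d d' y, Q d y → Q d' y → d = d')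
    (hdisj : ∀ d y e, Q d y → ¬ Q y e) (hQ : ∀ B, A ⊆ B → B ⊆ A ∪ F → W B → ∃ d ∈ B, ∃ y ∈ B, Q d y)
    (hinv : ∀ d y, Q d y → (d ∈ A → y ∉ A ∪ F) ∧ (y ∈ A → d ∉ A ∪ F)) : ¬ ForcesFirst W A F := by
  induction hn : F.card using Nat.strong_induction_on generalizing A F with
  | _ n ih =>
  subst hn
  rintro (hA | ⟨r, hr, hf⟩)
  · obtain ⟨d, hd, y, hy, h⟩ := hQ A subset_rfl Finset.subset_union_left hA
    exact (hinv d y h).1 hd (Finset.mem_union_left _ hy)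
  -- Cut's answer `c` to `r` preserves the invariant `hinv` as soon as no available vertex other
  -- than `c` is matched with `r`. So Cut takes the partner of `r` if it is available, and any
  -- vertex otherwise.
  · have key : ∀ c ∈ F, c ≠ r → (∀ d y, Q d y → (d = r → y ≠ c → y ∉ F) ∧
        (y = r → d ≠ c → d ∉ F)) → False := by
      intro c hc hcr hpart
      refine ih _ ?_ ?_ ?_ rfl (hf.after_cut (c := c) (by grind))
      · exact (Finset.card_le_card (Finset.erase_subset _ _)).trans_lt
          (Finset.card_erase_lt_of_mem hr)
      · intro B h1 h2
        exact hQ B (by grind) (by grind)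
      · intro d y hdy
        have h1 := hinv d y hdy
        have h2 := hpart d y hdy
        have h3 : d ≠ y := by rintro rfl; exact hdisj _ _ _ hdy hdy
        simp only [Finset.mem_union, Finset.mem_insert, Finset.mem_erase] at *
        grind
    by_cases h1 : ∃ c ∈ F, Q r c
    · obtain ⟨c, hc, hrc⟩ := h1
      refine key c hc ?_ ?_
      · rintro rfl
        exact hdisj _ _ _ hrc hrc
      · intro d y hdy
        exact ⟨fun h hy => (hy (hleft _ _ _ (h ▸ hdy) hrc)).elim,
          fun h => (hdisj _ _ c hdy (h ▸ hrc)).elim⟩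
    by_cases h2 : ∃ c ∈ F, Q c r
    · obtain ⟨c, hc, hcr⟩ := h2
      refine key c hc ?_ ?_
      · rintro rfl
        exact hdisj _ _ _ hcr hcr
      · intro d y hdy
        exact ⟨fun h => (hdisj c r y hcr (h ▸ hdy)).elim,
          fun h hd => (hd (hright _ _ _ (h ▸ hdy) hcr)).elim⟩
    push Not at h1 h2
    by_cases hc : ∃ c ∈ F, c ≠ r
    · obtain ⟨c, hc, hcr⟩ := hc
      refine key c hc hcr fun d y hdy => ⟨?_, ?_⟩
      · rintro rfl _ hy
        exact h1 y hy hdy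
      · rintro rfl _ hd
        exact h2 d hd hdy
    · push Not at hc
      obtain ⟨d, hd, y, hy, h⟩ := hQ _ (by grind) (by grind) (hf.win_all hW)
      have h3 := hinv d y h
      have h4 : d ≠ y := by rintro rfl; exact hdisj _ _ _ h h
      simp only [Finset.mem_union, Finset.mem_insert, Finset.mem_erase] at *
      grind

end Forcing

/-! ### Connection of the terminals through a set of vertices -/

section Joins

variable {V : Type u}

/-- The subgraph of `G` whose edges join vertices of `A ∪ {s, t}`. -/
def liveGraph (G : SimpleGraph V) (s t : V) (A : Finset V) : SimpleGraph V where
  Adj u v := G.Adj u v ∧ (u = s ∨ u = t ∨ u ∈ A) ∧ (v = s ∨ v = t ∨ v ∈ A)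
  symm := ⟨fun _ _ h => ⟨h.1.symm, h.2.2, h.2.1⟩⟩
  loopless := ⟨fun _ h => h.1.ne rfl⟩

/-- The terminals are joined through `A`. -/
def Joins (G : SimpleGraph V) (s t : V) (A : Finset V) : Prop :=
  (liveGraph G s t A).Reachable s t

theorem Joins.monotone (G : SimpleGraph V) (s t : V) : Monotone (Joins G s t) := by
  intro A B hAB h
  refine h.mono ?_
  intro u v huv
  exact ⟨huv.1, huv.2.1.imp_right (Or.imp_right (@hAB u)),
    huv.2.2.imp_right (Or.imp_right (@hAB v))⟩

theorem joins_comm {G : SimpleGraph V} {s t : V} {A : Finset V} :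
    Joins G s t A ↔ Joins G t s A := by
  have : liveGraph G s t A = liveGraph G t s A := by
    ext u v
    simp only [liveGraph]
    tauto
  unfold Joins
  rw [this]
  exact SimpleGraph.reachable_comm

theorem joins_comm_eq (G : SimpleGraph V) (s t : V) : Joins G s t = Joins G t s :=
  funext fun _ => propext joins_comm

theorem reachable_of_map {G H : SimpleGraph V} (φ : V → V)
    (h : ∀ u v, G.Adj u v → H.Reachable (φ u) (φ v)) {u v : V} (huv : G.Reachable u v) :
    H.Reachable (φ u) (φ v) := by
  obtain ⟨p⟩ := huv
  induction p with
  | nil => rfl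
  | cons hadj _ ih => exact (h _ _ hadj).trans ih

/-- Maps other than the identity serve to contract a useless vertex onto one of its neighbours. -/
theorem Joins.of_map {G H : SimpleGraph V} {s t : V} {A B : Finset V} (φ : V → V) (hs : φ s = s)
    (ht : φ t = t) (h : ∀ u v, (liveGraph G s t A).Adj u v →
      (liveGraph H s t B).Reachable (φ u) (φ v)) (hA : Joins G s t A) : Joins H s t B := by
  have := reachable_of_map φ h hA
  rwa [hs, ht] at this

theorem Joins.of_adj {G H : SimpleGraph V} {s t : V} {A B : Finset V}
    (h : ∀ u v, (liveGraph G s t A).Adj u v → (liveGraph H s t B).Reachable u v)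
    (hA : Joins G s t A) : Joins H s t B :=
  hA.of_map id rfl rfl h

/-- Reads a path backwards from `t`. The predecessor `w` of the last inner vertex differs from `t`
because a path visits `t` only once. -/
theorem Joins.exists_last {G : SimpleGraph V} {s t : V} {A : Finset V} (hst : s ≠ t)
    (h : Joins G s t A) : ∃ v, G.Adj v t ∧ (v = s ∨ v ∈ A) ∧
      (v ≠ s → ∃ w, G.Adj w v ∧ w ≠ t ∧ (w = s ∨ w ∈ A)) := by
  obtain ⟨p, hp⟩ := SimpleGraph.Reachable.exists_isPath h
  obtain ⟨q, hq⟩ : ∃ q : (liveGraph G s t A).Walk t s, q.IsPath := ⟨p.reverse, hp.reverse⟩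
  cases q with
  | nil => exact (hst rfl).elim
  | @cons _ v _ hadj q =>
    have hv : v ≠ t := hadj.ne.symm
    refine ⟨v, hadj.1.symm, hadj.2.2.imp_right fun h => h.resolve_left hv, fun hvs => ?_⟩
    cases q with
    | nil => exact (hvs rfl).elim
    | @cons _ w _ hadj' q =>
      have hw : w ≠ t := by
        rintro rfl
        simp [SimpleGraph.Walk.cons_isPath_iff] at hq
      exact ⟨w, hadj'.1.symm, hw, hadj'.2.2.imp_right fun h => h.resolve_left hw⟩

theorem liveGraph_deleteEdges_adj {G : SimpleGraph V} {s t : V} {A : Finset V} {u v : V}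
    {e : Sym2 V} (h : G.Adj u v)
    (hu : u = s ∨ u = t ∨ u ∈ A) (hv : v = s ∨ v = t ∨ v ∈ A) (he : s(u, v) ≠ e) :
    (liveGraph (G.deleteEdges {e}) s t A).Adj u v :=
  ⟨by simpa [SimpleGraph.deleteEdges_adj] using ⟨h, he⟩, hu, hv⟩

theorem joins_of_isChain {G : SimpleGraph V} {s t : V} {A : Finset V} (l : List V)
    (hl : ∀ v ∈ l, v ∈ A)
    (hc : List.IsChain G.Adj (s :: (l ++ [t]))) : Joins G s t A := by
  have key : ∀ (l : List V) (u : V), (u = s ∨ u = t ∨ u ∈ A) → (∀ v ∈ l, v ∈ A) →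
      List.IsChain G.Adj (u :: (l ++ [t])) → (liveGraph G s t A).Reachable u t := by
    intro l
    induction l with
    | nil =>
      intro u hu _ h
      have h : G.Adj u t := by simpa using h
      exact SimpleGraph.Adj.reachable ⟨h, hu, .inr (.inl rfl)⟩
    | cons v l ih =>
      intro u hu hl h
      rw [List.cons_append, List.isChain_cons_cons] at h
      have hv : v = s ∨ v = t ∨ v ∈ A := .inr (.inr (hl v (by simp)))
      exact (SimpleGraph.Adj.reachable (G := liveGraph G s t A) ⟨h.1, hu, hv⟩).trans
        (ih v hv (fun w hw => hl w (by simp [hw])) h.2)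
  exact key l s (.inl rfl) hl hc

theorem shortConnects_iff (L : ShannonGame V) (p : Position V) :
    L.ShortConnects p ↔ Joins L.graph L.s L.t p.short := by
  constructor
  · rintro ⟨γ, -, hγ⟩
    refine ⟨γ.transfer _ fun e he => ?_⟩
    induction e with
    | _ u v =>
      exact ⟨γ.adj_of_mem_edges he, hγ _ (γ.fst_mem_support_of_mem_edges he),
        hγ _ (γ.snd_mem_support_of_mem_edges he)⟩
  · intro h
    obtain ⟨p', hp'⟩ := SimpleGraph.Reachable.exists_isPath h
    have hle : liveGraph L.graph L.s L.t p.short ≤ L.graph := fun u v h => h.1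
    refine ⟨p'.mapLe hle, hp'.mapLe hle, ?_⟩
    intro v hv
    simp only [SimpleGraph.Walk.support_mapLe_eq_support] at hv
    clear hp'
    have key : ∀ a b (q : (liveGraph L.graph L.s L.t p.short).Walk a b),
        (a = L.s ∨ a = L.t ∨ a ∈ p.short) →
        ∀ v ∈ q.support, v = L.s ∨ v = L.t ∨ v ∈ p.short := by
      intro a b q
      induction q with
      | nil => intro ha v hv; simp at hv; exact hv ▸ ha
      | cons hadj q ih =>
        intro ha v hv
        rw [SimpleGraph.Walk.support_cons, List.mem_cons] at hv
        obtain rfl | hv := hv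
        · exact ha
        · exact ih hadj.2.2 v hv
    exact key _ _ p' (.inl rfl) v hv

end Joins

/-! ### Translation between game strategies and forcing, and determinacy -/

section Strategies

variable {V : Type u} [Fintype V] [DecidableEq V]

/-- The non-terminal vertices. -/
def inner (s t : V) : Finset V := Finset.univ.filter fun v => v ≠ s ∧ v ≠ t

@[simp]
theorem mem_inner {s t v : V} : v ∈ inner s t ↔ v ≠ s ∧ v ≠ t := by simp [inner]

theorem inner_comm (s t : V) : inner s t = inner t s := by
  ext v
  simp [and_comm]

/-- The uncoloured vertices. -/
def Position.free (L : ShannonGame V) (p : Position V) : Finset V :=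
  inner L.s L.t \ (p.short ∪ p.cut)

theorem mem_free {L : ShannonGame V} {p : Position V} {v : V} :
    v ∈ p.free L ↔ L.Free p v := by
  simp [Position.free, Free, and_assoc]

theorem free_play (L : ShannonGame V) (p : Position V) (P : Player) (v : V) :
    (p.play P v).free L = (p.free L).erase v := by
  ext w
  cases P <;> simp [Position.free, Position.play] <;> grind

theorem HasWinningStrategy.forces {L : ShannonGame V} {Q : Player} {p : Position V}
    (h : L.HasWinningStrategy .short Q p) :
    (Q = .cut → Forces (Joins L.graph L.s L.t) p.short (p.free L)) ∧
      (Q = .short → ForcesFirst (Joins L.graph L.s L.t) p.short (p.free L)) := by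
  induction h with
  | finished Q p hend hwon =>
    have := (shortConnects_iff L p).1 hwon
    exact ⟨fun _ => .done _ _ this, fun _ => .inl this⟩
  | ownMove p v hv _ ih =>
    refine ⟨by simp, fun _ => .inr ⟨v, mem_free.2 hv, ?_⟩⟩
    have := ih.1 rfl
    rwa [free_play] at this
  | opponentMove p hfree _ ih =>
    refine ⟨fun _ => ?_, fun h => by cases h⟩
    by_cases hw : Joins L.graph L.s L.t p.short
    · exact .done _ _ hw
    obtain ⟨v, hv⟩ := hfree
    refine .of_reply ⟨v, mem_free.2 hv⟩ fun c hc => ?_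
    have := (ih c (mem_free.1 hc)).2 rfl
    rw [free_play] at this
    obtain h | ⟨r, hr, h⟩ := this
    · exact (hw h).elim
    · exact ⟨r, Finset.mem_of_mem_erase hr, (Finset.mem_erase.1 hr).1, h⟩

/-- The game continues after Short has connected, whereas `Forces` stops there. With an invariant
that every move preserves, the remaining moves may be arbitrary. -/
theorem HasWinningStrategy.of_invariant {L : ShannonGame V} {P : Player}
    (I : Position V → Prop) (hplay : ∀ p Q v, I p → L.Free p v → I (p.play Q v))
    (hend : ∀ p, I p → L.WonBy p P) (Q : Player) (p : Position V) (hp : I p) :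
    L.HasWinningStrategy P Q p := by
  induction hn : (p.free L).card using Nat.strong_induction_on generalizing p Q with
  | _ n ih =>
  subst hn
  have hlt : ∀ v, L.Free p v → ∀ Q, ((p.play Q v).free L).card < (p.free L).card := by
    intro v hv Q
    rw [free_play]
    exact Finset.card_erase_lt_of_mem (mem_free.2 hv)
  by_cases hfree : ∃ v, L.Free p v
  · obtain rfl | rfl : Q = P ∨ Q = P.other := by cases P <;> cases Q <;> simp [Player.other]
    · obtain ⟨v, hv⟩ := hfree
      exact .ownMove p v hv (ih _ (hlt v hv _) _ _ (hplay _ _ _ hp hv) rfl)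
    · exact .opponentMove p hfree fun v hv => ih _ (hlt v hv _) _ _ (hplay _ _ _ hp hv) rfl
  · exact .finished Q p (by simpa using hfree) (hend p hp)

theorem hasWinningStrategy_of_joins {L : ShannonGame V} (Q : Player) {p : Position V}
    (hp : Joins L.graph L.s L.t p.short) : L.HasWinningStrategy .short Q p := by
  refine .of_invariant (P := .short) (fun p => Joins L.graph L.s L.t p.short) ?_
    (fun p hp => (shortConnects_iff L p).2 hp) Q p hp
  rintro p (_ | _) v h -
  · exact Joins.monotone _ _ _ (Finset.subset_insert v p.short) h
  · exact h

theorem Forces.hasWinningStrategy {L : ShannonGame V} {A F : Finset V}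
    (h : Forces (Joins L.graph L.s L.t) A F) {p : Position V} (hA : p.short = A)
    (hF : p.free L = F) : L.HasWinningStrategy .short .cut p := by
  induction h generalizing p with
  | done A F h => exact hasWinningStrategy_of_joins _ (hA ▸ h)
  | reply A F ρ hne hρ h ih =>
    subst hA hF
    obtain ⟨v, hv⟩ := hne
    refine .opponentMove p ⟨v, mem_free.1 hv⟩ fun c hc => ?_
    have hc' := mem_free.2 hc
    refine .ownMove _ (ρ c) ?_ (ih c hc' rfl ?_)
    · rw [← mem_free, free_play]
      exact Finset.mem_erase.2 ⟨(hρ c hc').2, (hρ c hc').1⟩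
    · rw [free_play, free_play]

theorem free_initial (L : ShannonGame V) : Position.initial.free L = inner L.s L.t := by
  simp [Position.free, Position.initial]

theorem winsFirst_short_iff (L : ShannonGame V) :
    L.WinsFirst .short ↔ ForcesFirst (Joins L.graph L.s L.t) ∅ (inner L.s L.t) := by
  constructor
  · intro h
    have := (HasWinningStrategy.forces h).2 rfl
    rwa [free_initial] at this
  · rintro (h | ⟨r, hr, h⟩)
    · exact hasWinningStrategy_of_joins _ h
    · refine .ownMove _ r ?_ (h.hasWinningStrategy rfl ?_)
      · rwa [← mem_free, free_initial]
      · rw [free_play, free_initial]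

theorem winsSecond_short_iff (L : ShannonGame V) :
    L.WinsSecond .short ↔ Forces (Joins L.graph L.s L.t) ∅ (inner L.s L.t) := by
  constructor
  · intro h
    have := (HasWinningStrategy.forces h).1 rfl
    rwa [free_initial] at this
  · exact fun h => h.hasWinningStrategy rfl (free_initial L)

/-- Zermelo's argument: if the player to move has no winning move, each of his moves leads to a
position won by the opponent. -/
theorem hasWinningStrategy_short_or_cut (L : ShannonGame V) (Q : Player) (p : Position V) :
    L.HasWinningStrategy .short Q p ∨ L.HasWinningStrategy .cut Q p := by
  induction hn : (p.free L).card using Nat.strong_induction_on generalizing p Q with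
  | _ n ih =>
  subst hn
  have ih' : ∀ v, L.Free p v → ∀ P Q, L.HasWinningStrategy .short Q (p.play P v) ∨
      L.HasWinningStrategy .cut Q (p.play P v) := by
    intro v hv P Q
    refine ih _ ?_ Q _ rfl
    rw [free_play]
    exact Finset.card_erase_lt_of_mem (mem_free.2 hv)
  by_cases hfree : ∃ v, L.Free p v
  · cases Q with
    | short =>
      by_cases h : ∃ v, L.Free p v ∧ L.HasWinningStrategy .short .cut (p.play .short v)
      · obtain ⟨v, hv, h⟩ := h
        exact .inl (.ownMove p v hv h)
      · push Not at h
        exact .inr (.opponentMove (P := .cut) p hfree fun v hv =>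
          (ih' v hv _ _).resolve_left (h v hv))
    | cut =>
      by_cases h : ∃ v, L.Free p v ∧ L.HasWinningStrategy .cut .short (p.play .cut v)
      · obtain ⟨v, hv, h⟩ := h
        exact .inr (.ownMove p v hv h)
      · push Not at h
        exact .inl (.opponentMove (P := .short) p hfree fun v hv =>
          (ih' v hv _ _).resolve_right (h v hv))
  · push Not at hfree
    by_cases h : L.ShortConnects p
    · exact .inl (.finished Q p hfree h)
    · exact .inr (.finished Q p hfree h)

theorem winsSecond_short_or_winsFirst_cut (L : ShannonGame V) :
    L.WinsSecond .short ∨ L.WinsFirst .cut :=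
  hasWinningStrategy_short_or_cut L .cut .initial

/-- Short has a first winning move, and none after the deletion of any edge. -/
def EdgeMinimal (G : SimpleGraph V) (s t : V) : Prop :=
  ForcesFirst (Joins G s t) ∅ (inner s t) ∧
    ∀ e ∈ G.edgeSet, ¬ ForcesFirst (Joins (G.deleteEdges {e}) s t) ∅ (inner s t)

/-- If Short won first after a deletion, determinacy would make the smaller game strong or weak. -/
theorem IsMinimalWeakLink.edgeMinimal {L : ShannonGame V} (h : L.IsMinimalWeakLink) :
    EdgeMinimal L.graph L.s L.t := by
  refine ⟨(winsFirst_short_iff L).1 h.1.1, fun e he hf => ?_⟩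
  have h1 : (L.deleteEdge e).WinsFirst .short := (winsFirst_short_iff (L.deleteEdge e)).2 hf
  obtain h2 | h2 := winsSecond_short_or_winsFirst_cut (L.deleteEdge e)
  · exact (h.2 e he).2 h2
  · exact (h.2 e he).1 ⟨h1, h2⟩

theorem EdgeMinimal.isMinimalWeakLink {L : ShannonGame V} (h : EdgeMinimal L.graph L.s L.t)
    (hs : ¬ L.IsStrongLink) : L.IsMinimalWeakLink := by
  refine ⟨⟨(winsFirst_short_iff L).2 h.1,
    (winsSecond_short_or_winsFirst_cut L).resolve_left hs⟩, fun e he => ⟨fun hw => ?_, fun hw => ?_⟩⟩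
  · exact h.2 e he ((winsFirst_short_iff (L.deleteEdge e)).1 hw.1)
  · exact h.2 e he (((winsSecond_short_iff (L.deleteEdge e)).1 hw).forcesFirst
      (Joins.monotone _ _ _))

theorem EdgeMinimal.symm {G : SimpleGraph V} {s t : V} (h : EdgeMinimal G s t) :
    EdgeMinimal G t s := by
  refine ⟨?_, fun e he => ?_⟩
  · rw [joins_comm_eq, inner_comm]
    exact h.1
  · rw [joins_comm_eq, inner_comm]
    exact h.2 e he

end Strategies

/-! ### Local consequences of edge-minimality -/

section Reroute

variable {V : Type u} [Fintype V] [DecidableEq V] {G : SimpleGraph V} {s t m : V}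

/-- Colouring `m` is a winning first move of Short. -/
def FirstMove (G : SimpleGraph V) (s t m : V) : Prop :=
  m ∈ inner s t ∧ Forces (Joins G s t) {m} ((inner s t).erase m)

theorem FirstMove.symm (h : FirstMove G s t m) : FirstMove G t s m := by
  unfold FirstMove at *
  rwa [joins_comm_eq, inner_comm]

theorem EdgeMinimal.exists_firstMove (h : EdgeMinimal G s t) (hw : (inner s t).Nonempty) :
    ∃ m, FirstMove G s t m := by
  obtain h | ⟨r, hr, h⟩ := h.1
  · obtain ⟨m, hm⟩ := hw
    exact ⟨m, hm, .done _ _ (Joins.monotone _ _ _ (Finset.empty_subset _) h)⟩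
  · exact ⟨r, hr, h⟩

theorem FirstMove.imp (hm : FirstMove G s t m) {H : SimpleGraph V}
    (h : ∀ A, m ∈ A → Joins G s t A → Joins H s t A) :
    ForcesFirst (Joins H s t) ∅ (inner s t) :=
  .inr ⟨m, hm.1, hm.2.imp fun B hB _ => h B (hB (Finset.mem_singleton_self m))⟩

/-- An edge that can be bypassed as soon as Short has made his first move does not exist. -/
theorem EdgeMinimal.false_of_reroute (h : EdgeMinimal G s t) (hm : FirstMove G s t m) {x y : V}
    (hxy : G.Adj x y)
    (H : ∀ A, m ∈ A → (x = s ∨ x = t ∨ x ∈ A) → (y = s ∨ y = t ∨ y ∈ A) → Joins G s t A →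
      (liveGraph (G.deleteEdges {s(x, y)}) s t A).Reachable x y ∨
        Joins (G.deleteEdges {s(x, y)}) s t A) : False := by
  refine h.2 s(x, y) hxy (hm.imp fun A hmA hA => ?_)
  by_cases hJ : Joins (G.deleteEdges {s(x, y)}) s t A
  · exact hJ
  refine hA.of_adj fun u v huv => ?_
  by_cases he : s(u, v) = s(x, y)
  · obtain ⟨rfl, rfl⟩ | ⟨rfl, rfl⟩ := Sym2.eq_iff.1 he
    · exact (H A hmA huv.2.1 huv.2.2 hA).resolve_right hJ
    · exact ((H A hmA huv.2.2 huv.2.1 hA).resolve_right hJ).symm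
  · exact (liveGraph_deleteEdges_adj huv.1 huv.2.1 huv.2.2 he).reachable

/-- The edge `pq` is bypassed by `p, s, q`. The next two lemmas use the bypasses `p, m, q` and `p,
s, m, q`, with `m` owned by Short. -/
theorem EdgeMinimal.not_adj_of_adj_start (h : EdgeMinimal G s t) (hm : FirstMove G s t m)
    {p q : V} (hp : G.Adj s p) (hq : G.Adj s q) : ¬ G.Adj p q := by
  intro hpq
  refine h.false_of_reroute hm hpq fun A _ hpA hqA _ => .inl ?_
  refine (liveGraph_deleteEdges_adj hp.symm hpA (.inl rfl) ?_).reachable.trans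
    (liveGraph_deleteEdges_adj hq (.inl rfl) hqA ?_).reachable
  all_goals
    have := hp.ne; have := hq.ne; have := hpq.ne
    simp only [ne_eq, Sym2.eq_iff]
    grind

theorem EdgeMinimal.not_adj_of_adj_firstMove (h : EdgeMinimal G s t) (hm : FirstMove G s t m)
    {p q : V} (hp : G.Adj m p) (hq : G.Adj m q) : ¬ G.Adj p q := by
  intro hpq
  refine h.false_of_reroute hm hpq fun A hmA hpA hqA _ => .inl ?_
  refine (liveGraph_deleteEdges_adj hp.symm hpA (.inr (.inr hmA)) ?_).reachable.trans
    (liveGraph_deleteEdges_adj hq (.inr (.inr hmA)) hqA ?_).reachable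
  all_goals
    have := hp.ne; have := hq.ne; have := hpq.ne
    simp only [ne_eq, Sym2.eq_iff]
    grind

theorem EdgeMinimal.not_adj_of_adj_start_firstMove (h : EdgeMinimal G s t)
    (hm : FirstMove G s t m) (hsm : G.Adj s m) {p q : V} (hp : G.Adj s p) (hq : G.Adj m q)
    (hpm : p ≠ m) (hqs : q ≠ s) : ¬ G.Adj p q := by
  intro hpq
  refine h.false_of_reroute hm hpq fun A hmA hpA hqA _ => .inl ?_
  refine ((liveGraph_deleteEdges_adj hp.symm hpA (.inl rfl) ?_).reachable.trans
    (liveGraph_deleteEdges_adj hsm (.inl rfl) (.inr (.inr hmA)) ?_).reachable).trans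
    (liveGraph_deleteEdges_adj hq (.inr (.inr hmA)) hqA ?_).reachable
  all_goals
    have := hp.ne; have := hq.ne; have := hpq.ne; have := hsm.ne
    simp only [ne_eq, Sym2.eq_iff]
    grind

/-- If the first move joins `t` to a neighbour `x` of `s`, then `x` has no other neighbours. -/
theorem EdgeMinimal.not_adj_of_path (h : EdgeMinimal G s t) (hm : FirstMove G s t m)
    (hmt : G.Adj m t) {x z : V} (hmx : G.Adj m x) (hsx : G.Adj s x) (hzs : z ≠ s) (hzm : z ≠ m) :
    ¬ G.Adj x z := by
  intro hxz
  refine h.false_of_reroute hm hxz fun A hmA hxA _ _ => .inr ?_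
  refine ((liveGraph_deleteEdges_adj hsx (.inl rfl) hxA ?_).reachable.trans
    (liveGraph_deleteEdges_adj hmx.symm hxA (.inr (.inr hmA)) ?_).reachable).trans
    (liveGraph_deleteEdges_adj hmt (.inr (.inr hmA)) (.inr (.inl rfl)) ?_).reachable
  all_goals
    have := hmt.ne; have := hmx.ne; have := hsx.ne; have := hxz.ne
    simp only [ne_eq, Sym2.eq_iff]
    grind

/-- A vertex `v` with the single neighbour `u` can be contracted onto `u`, so its edge is
dispensable. -/
theorem EdgeMinimal.exists_adj_ne (h : EdgeMinimal G s t) (hm : FirstMove G s t m) {v u : V}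
    (hv : v ∈ inner s t) (hvu : G.Adj v u) : ∃ w, G.Adj v w ∧ w ≠ u := by
  by_contra! hcon
  rw [mem_inner] at hv
  refine h.2 s(v, u) hvu (hm.imp fun A _ hA => ?_)
  refine hA.of_map (fun w => if w = v then u else w) (if_neg hv.1.symm) (if_neg hv.2.symm) ?_
  intro a b hab
  have hne := hab.ne
  by_cases ha : a = v
  · subst ha
    rw [if_pos rfl, if_neg hne.symm, hcon b hab.1]
  by_cases hb : b = v
  · subst hb
    rw [if_pos rfl, if_neg hne, hcon a hab.1.symm]
  rw [if_neg ha, if_neg hb]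
  refine (liveGraph_deleteEdges_adj hab.1 hab.2.1 hab.2.2 ?_).reachable
  simp only [ne_eq, Sym2.eq_iff]
  grind

/-- A first winning move has at least three neighbours: otherwise Cut makes it worthless. -/
theorem EdgeMinimal.exists_third_neighbor (h : EdgeMinimal G s t) (hm : FirstMove G s t m)
    {p : V} (q : V) (hp : p ∈ inner s t) (hmp : G.Adj m p) : ∃ r, G.Adj m r ∧ r ≠ p ∧ r ≠ q := by
  by_contra! hcon
  have hmi := mem_inner.1 hm.1
  have hpi := mem_inner.1 hp
  refine h.2 s(m, p) hmp ?_
  -- Let Cut answer `m` with `p`. The only neighbour of `m` that can still matter is `q`, so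
  -- contracting `m` onto `q` shows that Short wins without `m`, hence also without the edge `mp`.
  have key : ∀ B, p ∉ B → Joins G s t B → Joins (G.deleteEdges {s(m, p)}) s t (B.erase m) := by
    intro B hpB hB
    refine hB.of_map (fun w => if w = m then q else w) (if_neg hmi.1.symm) (if_neg hmi.2.symm) ?_
    intro a b hab
    have hne := hab.ne
    have hap : a ≠ p := by
      rintro rfl
      have := hab.2.1
      grind
    have hbp : b ≠ p := by
      rintro rfl
      have := hab.2.2
      grind
    by_cases ha : a = m
    · subst ha
      rw [if_pos rfl, if_neg hne.symm, hcon b hab.1 hbp]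
    by_cases hb : b = m
    · subst hb
      rw [if_pos rfl, if_neg hne, hcon a hab.1.symm hap]
    rw [if_neg ha, if_neg hb]
    have h1 := hab.2.1
    have h2 := hab.2.2
    refine (liveGraph_deleteEdges_adj hab.1 ?_ ?_ ?_).reachable
    · grind
    · grind
    · simp only [ne_eq, Sym2.eq_iff]
      grind
  obtain hf | ⟨r, hr, hf⟩ :=
    hm.2.after_cut (c := p) (Finset.mem_erase.2 ⟨hmp.ne.symm, hp⟩)
  · have := key _ (by simpa using hmp.ne.symm) hf
    exact .inl (by simpa using this)
  · simp only [Finset.mem_erase] at hr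
    refine .inr ⟨r, hr.2.2, ?_⟩
    have h1 : Forces (fun B => Joins (G.deleteEdges {s(m, p)}) s t (B.erase m))
        (insert r {m}) (((((inner s t).erase m).erase p).erase r)) := by
      refine hf.imp fun B _ hB => key B ?_
      have := @hB p
      have := hmp.ne
      simp only [Finset.mem_union, Finset.mem_insert, Finset.mem_erase, Finset.mem_singleton] at *
      grind
    have h2 := h1.erase (W' := Joins (G.deleteEdges {s(m, p)}) s t) (m := m) (by simp)
      (fun B hB => hB)
    refine h2.mono (Joins.monotone _ _ _) (fun _ _ h => h) ?_ ?_
    · intro v hv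
      simp only [Finset.mem_insert, Finset.mem_erase, Finset.mem_singleton] at *
      grind
    · intro v hv
      simp only [Finset.mem_union, Finset.mem_insert, Finset.mem_erase] at *
      grind

end Reroute

/-! ### Subgraphs on which Short wins moving first -/

section Patterns

variable {V : Type u} [Fintype V] [DecidableEq V] {G : SimpleGraph V} {s t : V}

/-- Extends a local strategy, with opening `x` and all later moves in `F`, to the whole board. -/
theorem forcesFirst_of_forces {W : Finset V → Prop} (hW : Monotone W) {x : V} {F : Finset V}
    (hx : x ∈ inner s t) (hF : F ⊆ inner s t) (hJ : ∀ B, x ∈ B → W B → Joins G s t B)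
    (h : Forces W {x} F) : ForcesFirst (Joins G s t) ∅ (inner s t) := by
  refine .inr ⟨x, hx, h.mono hW (fun B hB => hJ B (hB (by simp))) (by simp) ?_⟩
  intro v hv
  have := hF hv
  simp only [Finset.mem_union, Finset.mem_insert, Finset.mem_erase]
  grind

/-- `s` and `y` are joined by a bridge, and `y` is adjacent to `t`. -/
theorem forcesFirst_bridge_edge {a a' y : V} (hn : [s, t, a, a', y].Nodup) (h1 : G.Adj s a)
    (h2 : G.Adj s a') (h3 : G.Adj a y) (h4 : G.Adj a' y) (h5 : G.Adj y t) :
    ForcesFirst (Joins G s t) ∅ (inner s t) := by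
  simp only [List.nodup_cons, List.mem_cons, not_or, List.not_mem_nil] at hn
  refine forcesFirst_of_forces (monotone_pair a a') (x := y) (by simp; grind) ?_ ?_
    (forces_pair (by grind))
  · simp [Finset.insert_subset_iff]
    grind
  · rintro B hy (hB | hB)
    · exact joins_of_isChain [a, y] (by simp [*]) (by simp [*])
    · exact joins_of_isChain [a', y] (by simp [*]) (by simp [*])

/-- `s` and `x`, and `x` and `t`, are joined by bridges. -/
theorem forcesFirst_bridge_bridge {a a' x b b' : V} (hn : [s, t, a, a', x, b, b'].Nodup)
    (h1 : G.Adj s a) (h2 : G.Adj s a') (h3 : G.Adj a x) (h4 : G.Adj a' x) (h5 : G.Adj x b)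
    (h6 : G.Adj x b') (h7 : G.Adj b t) (h8 : G.Adj b' t) :
    ForcesFirst (Joins G s t) ∅ (inner s t) := by
  simp only [List.nodup_cons, List.mem_cons, not_or, List.not_mem_nil] at hn
  refine forcesFirst_of_forces (W := fun B => (a ∈ B ∨ a' ∈ B) ∧ (b ∈ B ∨ b' ∈ B))
    (fun B B' h => And.imp (monotone_pair a a' h) (monotone_pair b b' h)) (x := x)
    (F := {a, a'} ∪ {b, b'}) (by simp; grind) ?_ ?_
    (.and (monotone_pair a a') (monotone_pair b b') (forces_pair (A := ∅) (by grind))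
      (forces_pair (A := ∅) (by grind)) (by simp) (by simp) ?_)
  · simp [Finset.insert_subset_iff]
    grind
  · rintro B hy ⟨hB | hB, hB' | hB'⟩
    · exact joins_of_isChain [a, x, b] (by simp [*]) (by simp [*])
    · exact joins_of_isChain [a, x, b'] (by simp [*]) (by simp [*])
    · exact joins_of_isChain [a', x, b] (by simp [*]) (by simp [*])
    · exact joins_of_isChain [a', x, b'] (by simp [*]) (by simp [*])
  · simp [Finset.disjoint_left]
    grind

/-- `x` is adjacent to `s` and joined to `t` through `y`, or through a bridge to `y'`. -/
theorem forcesFirst_edge_detour {x y y' z z' : V} (hn : [s, t, x, y, y', z, z'].Nodup)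
    (h1 : G.Adj s x) (h2 : G.Adj x y) (h3 : G.Adj y t) (h4 : G.Adj x z) (h5 : G.Adj x z')
    (h6 : G.Adj z y') (h7 : G.Adj z' y') (h8 : G.Adj y' t) :
    ForcesFirst (Joins G s t) ∅ (inner s t) := by
  refine forcesFirst_of_forces (monotone_pair_threat y y' z z') (x := x) ?_ ?_ ?_
    (.pair_threat ?_)
  all_goals simp only [List.nodup_cons, List.mem_cons, not_or, List.not_mem_nil] at hn ⊢
  · simp; grind
  · simp [Finset.insert_subset_iff]
    grind
  · rintro B hx (hB | ⟨hu, hB | hB⟩)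
    · exact joins_of_isChain [x, y] (by simp [*]) (by simp [*])
    · exact joins_of_isChain [x, z, y'] (by simp [*]) (by simp [*])
    · exact joins_of_isChain [x, z', y'] (by simp [*]) (by simp [*])
  · grind

/-- The paths `s, x', y', t` and `s, x, y, t`, and a vertex `z` joining `x` to `y'`. -/
theorem forcesFirst_two_paths {x x' y y' z : V} (hn : [s, t, x, x', y, y', z].Nodup)
    (h1 : G.Adj s x) (h2 : G.Adj x y) (h3 : G.Adj y t) (h4 : G.Adj s x') (h5 : G.Adj x' y')
    (h6 : G.Adj y' t) (h7 : G.Adj x z) (h8 : G.Adj z y') :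
    ForcesFirst (Joins G s t) ∅ (inner s t) := by
  refine forcesFirst_of_forces (monotone_pair_threat x' x y z) (x := y') ?_ ?_ ?_
    (.pair_threat ?_)
  all_goals simp only [List.nodup_cons, List.mem_cons, not_or, List.not_mem_nil] at hn ⊢
  · simp; grind
  · simp [Finset.insert_subset_iff]
    grind
  · rintro B hx (hB | ⟨hu, hB | hB⟩)
    · exact joins_of_isChain [x', y'] (by simp [*]) (by simp [*])
    · exact joins_of_isChain [x, y] (by simp [*]) (by simp [*])
    · exact joins_of_isChain [x, z, y'] (by simp [*]) (by simp [*])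
  · grind

/-- The exceptional link. -/
theorem forcesFirst_bridge_detour {a a' x b z z' d : V}
    (hn : [s, t, a, a', x, b, z, z', d].Nodup) (h1 : G.Adj s a) (h2 : G.Adj s a')
    (h3 : G.Adj a x) (h4 : G.Adj a' x) (h5 : G.Adj x b) (h6 : G.Adj b t) (h7 : G.Adj x z)
    (h8 : G.Adj x z') (h9 : G.Adj z d) (h10 : G.Adj z' d) (h11 : G.Adj d t) :
    ForcesFirst (Joins G s t) ∅ (inner s t) := by
  refine forcesFirst_of_forces
    (W := fun B => (a ∈ B ∨ a' ∈ B) ∧ (b ∈ B ∨ d ∈ B ∧ (z ∈ B ∨ z' ∈ B)))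
    (fun B B' h => And.imp (monotone_pair a a' h) (monotone_pair_threat b d z z' h)) (x := x)
    (F := {a, a'} ∪ {b, d, z, z'}) ?_ ?_ ?_
    (.and (monotone_pair a a') (monotone_pair_threat b d z z') (forces_pair (A := ∅) ?_)
      (.pair_threat (A := ∅) ?_) (by simp) (by simp) ?_)
  all_goals simp only [List.nodup_cons, List.mem_cons, not_or, List.not_mem_nil] at hn ⊢
  · simp; grind
  · simp [Finset.insert_subset_iff]
    grind
  · rintro B hx ⟨hB | hB, hB' | ⟨hd, hB' | hB'⟩⟩
    · exact joins_of_isChain [a, x, b] (by simp [*]) (by simp [*])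
    · exact joins_of_isChain [a, x, z, d] (by simp [*]) (by simp [*])
    · exact joins_of_isChain [a, x, z', d] (by simp [*]) (by simp [*])
    · exact joins_of_isChain [a', x, b] (by simp [*]) (by simp [*])
    · exact joins_of_isChain [a', x, z, d] (by simp [*]) (by simp [*])
    · exact joins_of_isChain [a', x, z', d] (by simp [*]) (by simp [*])
  · grind
  · grind
  · simp [Finset.disjoint_left]
    grind

/-- `s` and `x` are joined by a bridge, and `x` to `t` through `b`, or through `z` and a bridge. -/
theorem forcesFirst_bridge_detour_bridge {a a' x b z d d' : V}
    (hn : [s, t, a, a', x, b, z, d, d'].Nodup) (h1 : G.Adj s a) (h2 : G.Adj s a')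
    (h3 : G.Adj a x) (h4 : G.Adj a' x) (h5 : G.Adj x b) (h6 : G.Adj b t) (h7 : G.Adj x z)
    (h8 : G.Adj z d) (h9 : G.Adj z d') (h10 : G.Adj d t) (h11 : G.Adj d' t) :
    ForcesFirst (Joins G s t) ∅ (inner s t) := by
  refine forcesFirst_of_forces
    (W := fun B => (a ∈ B ∨ a' ∈ B) ∧ (b ∈ B ∨ z ∈ B ∧ (d ∈ B ∨ d' ∈ B)))
    (fun B B' h => And.imp (monotone_pair a a' h) (monotone_pair_threat b z d d' h)) (x := x)
    (F := {a, a'} ∪ {b, z, d, d'}) ?_ ?_ ?_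
    (.and (monotone_pair a a') (monotone_pair_threat b z d d') (forces_pair (A := ∅) ?_)
      (.pair_threat (A := ∅) ?_) (by simp) (by simp) ?_)
  all_goals simp only [List.nodup_cons, List.mem_cons, not_or, List.not_mem_nil] at hn ⊢
  · simp; grind
  · simp [Finset.insert_subset_iff]
    grind
  · rintro B hx ⟨hB | hB, hB' | ⟨hd, hB' | hB'⟩⟩
    · exact joins_of_isChain [a, x, b] (by simp [*]) (by simp [*])
    · exact joins_of_isChain [a, x, z, d] (by simp [*]) (by simp [*])
    · exact joins_of_isChain [a, x, z, d'] (by simp [*]) (by simp [*])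
    · exact joins_of_isChain [a', x, b] (by simp [*]) (by simp [*])
    · exact joins_of_isChain [a', x, z, d] (by simp [*]) (by simp [*])
    · exact joins_of_isChain [a', x, z, d'] (by simp [*]) (by simp [*])
  · grind
  · grind
  · simp [Finset.disjoint_left]
    grind

/-- The first move `d` threatens `s, a, d, t`; the answer is to join `s` and `x` by a bridge. -/
theorem forcesFirst_threat_bridge {a a' a'' x b z d : V}
    (hn : [s, t, a, a', a'', x, b, z, d].Nodup) (h1 : G.Adj s a) (h2 : G.Adj s a')
    (h3 : G.Adj s a'') (h4 : G.Adj a' x) (h5 : G.Adj a'' x) (h6 : G.Adj x b) (h7 : G.Adj b t)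
    (h8 : G.Adj x z) (h9 : G.Adj z d) (h10 : G.Adj a d) (h11 : G.Adj d t) :
    ForcesFirst (Joins G s t) ∅ (inner s t) := by
  have hW : Monotone fun B : Finset V => (a' ∈ B ∨ a'' ∈ B) ∧ (b ∈ B ∨ z ∈ B) :=
    fun B B' h => And.imp (monotone_pair a' a'' h) (monotone_pair b z h)
  simp only [List.nodup_cons, List.mem_cons, not_or, List.not_mem_nil] at hn
  refine forcesFirst_of_forces
    (W := fun B => a ∈ B ∨ x ∈ B ∧ (a' ∈ B ∨ a'' ∈ B) ∧ (b ∈ B ∨ z ∈ B))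
    (fun B B' h => Or.imp (@h a) (And.imp (@h x) (@hW _ _ h))) (x := d)
    (F := insert a (insert x ({a', a''} ∪ {b, z}))) ?_ ?_ ?_
    (.threat (by simp) (Forces.imp (.and (monotone_pair a' a'') (monotone_pair b z)
      (forces_pair (A := ∅) ?_) (forces_pair (A := ∅) ?_) (by simp) (by simp) ?_) ?_) ?_ ?_ ?_)
  · simp; grind
  · simp [Finset.insert_subset_iff]
    grind
  · rintro B hx (hB | ⟨hd, hB | hB, hB' | hB'⟩)
    · exact joins_of_isChain [a, d] (by simp [*]) (by simp [*])
    · exact joins_of_isChain [a', x, b] (by simp [*]) (by simp [*])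
    · exact joins_of_isChain [a', x, z, d] (by simp [*]) (by simp [*])
    · exact joins_of_isChain [a'', x, b] (by simp [*]) (by simp [*])
    · exact joins_of_isChain [a'', x, z, d] (by simp [*]) (by simp [*])
  · grind
  · grind
  · simp [Finset.disjoint_left]
    grind
  · exact fun B hB _ h => .inr ⟨hB (by simp), h⟩
  · grind
  · simp
    grind
  · simp
    grind

end Patterns

/-! ### Forbidden patterns in large connected minimal links -/

section Structure

variable {V : Type u} [Fintype V] [DecidableEq V] {G : SimpleGraph V} {s t m : V}

/-- A connected minimal weak link of weight greater than `5`, with first winning move `m`. -/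
structure LargeMinimal (G : SimpleGraph V) (s t m : V) : Prop where
  ne : s ≠ t
  edgeMinimal : EdgeMinimal G s t
  connected : G.Connected
  weight : 5 < (inner s t).card
  firstMove : FirstMove G s t m

namespace LargeMinimal

theorem symm (h : LargeMinimal G s t m) : LargeMinimal G t s m :=
  ⟨h.ne.symm, h.edgeMinimal.symm, h.connected, by rw [inner_comm]; exact h.weight,
    h.firstMove.symm⟩

theorem card_eq (h : LargeMinimal G s t m) : Fintype.card V = (inner s t).card + 2 := by
  have : inner s t = (Finset.univ.erase s).erase t := by
    ext v
    simp [and_comm]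
  rw [this, Finset.card_erase_of_mem (by simpa using h.ne.symm),
    Finset.card_erase_of_mem (by simp), Finset.card_univ]
  have : 1 < Fintype.card V := Fintype.one_lt_card_iff.2 ⟨s, t, h.ne⟩
  omega

theorem exists_adj (h : LargeMinimal G s t m) (v : V) : ∃ w, G.Adj v w := by
  have : Nontrivial V := ⟨s, t, h.ne⟩
  exact h.connected.preconnected.exists_adj_of_nontrivial v

/-- The vertices of a subgraph on which Short wins are more than seven. -/
theorem false_of_small (h : LargeMinimal G s t m) (l : List V) (hl : l.length ≤ 7)
    (H : ∀ G' : SimpleGraph V, (∀ u ∈ l, ∀ v ∈ l, G.Adj u v → G'.Adj u v) →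
      ForcesFirst (Joins G' s t) ∅ (inner s t)) : False := by
  -- There are at least eight vertices, since `w > 5`. Connectedness gives the outside vertex `o` an
  -- edge, whose deletion leaves all edges inside `l` intact.
  obtain ⟨o, ho⟩ : ∃ o, o ∉ l := by
    by_contra! hcon
    have h1 : Fintype.card V ≤ l.toFinset.card :=
      Finset.card_le_card (s := Finset.univ) fun v _ => by simpa using hcon v
    have := h1.trans l.toFinset_card_le
    have := h.card_eq
    have := h.weight
    omega
  obtain ⟨w, hw⟩ := h.exists_adj o
  refine h.edgeMinimal.2 s(o, w) hw (H _ fun u hu v hv huv => ?_)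
  rw [SimpleGraph.deleteEdges_adj]
  refine ⟨huv, ?_⟩
  simp only [Set.mem_singleton_iff, Sym2.eq_iff]
  grind

theorem not_adj (h : LargeMinimal G s t m) : ¬ G.Adj s t := by
  intro hst
  refine h.false_of_small [s, t] (by simp) fun G' hG => .inl ?_
  exact joins_of_isChain [] (by simp) (by simpa using hG s (by simp) t (by simp) hst)

theorem no_common (h : LargeMinimal G s t m) {v : V} (hs : G.Adj s v) : ¬ G.Adj t v := by
  intro ht
  refine h.false_of_small [s, t, v] (by simp) fun G' hG => .inr ⟨v, ?_, .done _ _ ?_⟩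
  · simpa using ⟨hs.ne.symm, ht.ne.symm⟩
  · refine joins_of_isChain [v] (by simp) ?_
    simpa using ⟨hG s (by simp) v (by simp) hs, hG v (by simp) t (by simp) ht.symm⟩

theorem indep_start (h : LargeMinimal G s t m) {p q : V} (hp : G.Adj s p) (hq : G.Adj s q) :
    ¬ G.Adj p q :=
  h.edgeMinimal.not_adj_of_adj_start h.firstMove hp hq

theorem indep_end (h : LargeMinimal G s t m) {p q : V} (hp : G.Adj t p) (hq : G.Adj t q) :
    ¬ G.Adj p q :=
  h.symm.indep_start hp hq

theorem indep_move (h : LargeMinimal G s t m) {p q : V} (hp : G.Adj m p) (hq : G.Adj m q) :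
    ¬ G.Adj p q :=
  h.edgeMinimal.not_adj_of_adj_firstMove h.firstMove hp hq

theorem indep_start_move (h : LargeMinimal G s t m) (hsm : G.Adj s m) {p q : V}
    (hp : G.Adj s p) (hq : G.Adj m q) (hpm : p ≠ m) (hqs : q ≠ s) : ¬ G.Adj p q :=
  h.edgeMinimal.not_adj_of_adj_start_firstMove h.firstMove hsm hp hq hpm hqs

theorem not_adj_of_path (h : LargeMinimal G s t m) (htm : G.Adj t m) {x z : V}
    (hmx : G.Adj m x) (hsx : G.Adj s x) (hzs : z ≠ s) (hzm : z ≠ m) : ¬ G.Adj x z :=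
  h.edgeMinimal.not_adj_of_path h.firstMove htm.symm hmx hsx hzs hzm

theorem exists_second (h : LargeMinimal G s t m) {v : V} (u : V) (hs : v ≠ s) (ht : v ≠ t) :
    ∃ w, G.Adj v w ∧ w ≠ u := by
  obtain ⟨w, hw⟩ := h.exists_adj v
  by_cases hwu : w = u
  · subst hwu
    exact h.edgeMinimal.exists_adj_ne h.firstMove (by simp [hs, ht]) hw
  · exact ⟨w, hw, hwu⟩

theorem exists_third (h : LargeMinimal G s t m) {p : V} (q : V) (hs : p ≠ s) (ht : p ≠ t)
    (hmp : G.Adj m p) : ∃ r, G.Adj m r ∧ r ≠ p ∧ r ≠ q :=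
  h.edgeMinimal.exists_third_neighbor h.firstMove q (by simp [hs, ht]) hmp

theorem move_ne (h : LargeMinimal G s t m) : m ≠ s ∧ m ≠ t := by
  simpa using h.firstMove.1

theorem no_bridge (h : LargeMinimal G s t m) {a a' y : V} (h1 : G.Adj s a) (h2 : G.Adj s a')
    (h3 : a ≠ a') (h4 : G.Adj a y) (h5 : G.Adj a' y) : ¬ G.Adj t y := by
  intro h6
  have := h.ne
  have := h.not_adj
  refine h.false_of_small [s, t, a, a', y] (by simp) fun G' hG => ?_
  refine forcesFirst_bridge_edge (a := a) (a' := a') (y := y) ?_ (hG _ ?_ _ ?_ h1)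
    (hG _ ?_ _ ?_ h2) (hG _ ?_ _ ?_ h4) (hG _ ?_ _ ?_ h5) (hG _ ?_ _ ?_ h6.symm)
  · have := h1.ne; have := h2.ne; have := h4.ne; have := h5.ne; have := h6.ne
    simp only [List.nodup_cons, List.mem_cons, not_or, List.not_mem_nil]
    grind [SimpleGraph.adj_comm]
  all_goals simp

/-- The first move is forced if it is the only neighbour of a terminal. -/
theorem eq_move_of_unique (h : LargeMinimal G s t m) {x : V} (hx : ∀ v, G.Adj s v → v = x) :
    m = x := by
  by_contra hne
  obtain ⟨y, hy⟩ := h.exists_adj s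
  obtain rfl := hx y hy
  have hyt : y ≠ t := by
    rintro rfl
    exact h.not_adj hy
  have := (h.firstMove.2.after_cut (c := y) (by simp [hyt, hy.ne.symm, Ne.symm hne])).win_all
    (Joins.monotone _ _ _)
  obtain ⟨v, hv, hv', -⟩ := (joins_comm.1 this).exists_last h.ne.symm
  obtain rfl := hx v hv.symm
  simp [hyt, Ne.symm hne] at hv'

/-- Together the neighbourhoods of the terminals do not contain all other vertices. -/
theorem not_covered (h : LargeMinimal G s t m)
    (hcov : ∀ v, v ≠ s → v ≠ t → G.Adj s v ∨ G.Adj t v) : False := by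
  have key : ∀ {s t : V}, LargeMinimal G s t m →
      (∀ v, v ≠ s → v ≠ t → G.Adj s v ∨ G.Adj t v) → ¬ G.Adj s m := by
    intro s t h hcov hsm
    -- Since the neighbours of `s` are independent, all neighbours of `m` except `s` are adjacent to
    -- `t`. Two of them form a bridge between `t` and `m`.
    have h1 : ∀ v, G.Adj m v → v ≠ s → v ≠ t ∧ G.Adj t v := by
      intro v hv hvs
      have hvt : v ≠ t := by
        rintro rfl
        exact h.no_common hsm hv.symm
      exact ⟨hvt, (hcov v hvs hvt).resolve_left fun h' => h.indep_start hsm h' hv⟩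
    obtain ⟨p, hp, hps⟩ := h.exists_second s h.move_ne.1 h.move_ne.2
    obtain ⟨r, hr, hrp, hrs⟩ := h.exists_third s hps (h1 p hp hps).1 hp
    exact h.symm.no_bridge (h1 p hp hps).2 (h1 r hr hrs).2 hrp.symm hp.symm hr.symm hsm
  obtain h1 | h1 := hcov m h.move_ne.1 h.move_ne.2
  · exact key h hcov h1
  · exact key h.symm (fun v h1 h2 => (hcov v h2 h1).symm) h1

/-- If `z` and `z'` both differ from `s`, the pattern of `forcesFirst_edge_detour` occupies only
seven vertices. -/
theorem no_detour (h : LargeMinimal G s t m) {x y y' z z' : V} (h1 : G.Adj s x) (h2 : G.Adj x y)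
    (h3 : G.Adj t y) (h4 : G.Adj x z) (h5 : G.Adj x z') (h6 : G.Adj z y') (h7 : G.Adj z' y')
    (h8 : G.Adj t y') (hy : y ≠ y') (hz : z ≠ z') (hs : ¬ G.Adj s y') : z = s ∨ z' = s := by
  by_contra! hcon
  have := h.ne
  have := h.not_adj
  have hzt : ¬ G.Adj t z := fun h' => h.indep_end h' h8 h6
  have hzt' : ¬ G.Adj t z' := fun h' => h.indep_end h' h8 h7
  have hxt := h.no_common h1
  refine h.false_of_small [s, t, x, y, y', z, z'] (by simp) fun G' hG => ?_
  refine forcesFirst_edge_detour (x := x) (y := y) (y' := y') (z := z) (z' := z') ?_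
    (hG _ ?_ _ ?_ h1) (hG _ ?_ _ ?_ h2) (hG _ ?_ _ ?_ h3.symm) (hG _ ?_ _ ?_ h4)
    (hG _ ?_ _ ?_ h5) (hG _ ?_ _ ?_ h6) (hG _ ?_ _ ?_ h7) (hG _ ?_ _ ?_ h8.symm)
  · have := h1.ne; have := h2.ne; have := h3.ne; have := h4.ne; have := h5.ne; have := h6.ne
    have := h7.ne; have := h8.ne
    simp only [List.nodup_cons, List.mem_cons, not_or, List.not_mem_nil]
    grind [SimpleGraph.adj_comm]
  all_goals simp

/-- A vertex adjacent to a terminal does not violate the bound. -/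
theorem false_of_adj_terminal [DecidableRel G.Adj] (h : LargeMinimal G s t m) {x y : V}
    (hsx : G.Adj s x) (hxy : G.Adj x y) (hty : G.Adj t y)
    (hcov : ∀ v, v ≠ s → v ≠ t → v ≠ x → G.Adj x v ∨ G.Adj s v ∨ G.Adj t v)
    (hs2 : G.degree s ≤ 2) (ht2 : G.degree t ≤ 2) : False := by
  have hst := h.not_adj
  have hxt : ¬ G.Adj t x := h.no_common hsx
  have hsy : ¬ G.Adj s y := fun h' => h.no_common h' hty
  have hs3 : ∀ p q, G.Adj s p → G.Adj s q → p ≠ x → q ≠ x → p = q := by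
    intro p q hp hq hpx hqx
    by_contra hpq
    have : 2 < (G.neighborFinset s).card :=
      Finset.two_lt_card.2 ⟨x, by simpa, p, by simpa, q, by simpa, hpx.symm, hqx.symm, hpq⟩
    rw [SimpleGraph.card_neighborFinset_eq_degree] at this
    omega
  have ht3 : ∀ p q, G.Adj t p → G.Adj t q → p ≠ y → q ≠ y → p = q := by
    intro p q hp hq hpx hqx
    by_contra hpq
    have : 2 < (G.neighborFinset t).card :=
      Finset.two_lt_card.2 ⟨y, by simpa, p, by simpa, q, by simpa, hpx.symm, hqx.symm, hpq⟩
    rw [SimpleGraph.card_neighborFinset_eq_degree] at this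
    omega
  -- At least six inner vertices, minus at most two neighbours of each terminal, leave two. By
  -- `hcov` both are adjacent to `x`.
  obtain ⟨z, z', hz, hz', hzz⟩ : ∃ z z', (z ≠ s ∧ z ≠ t ∧ ¬ G.Adj s z ∧ ¬ G.Adj t z) ∧
      (z' ≠ s ∧ z' ≠ t ∧ ¬ G.Adj s z' ∧ ¬ G.Adj t z') ∧ z ≠ z' := by
    have h1 : 1 < ((inner s t \ G.neighborFinset s) \ G.neighborFinset t).card := by
      have h1 := Finset.le_card_sdiff (G.neighborFinset s) (inner s t)
      have h2 := Finset.le_card_sdiff (G.neighborFinset t) (inner s t \ G.neighborFinset s)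
      rw [SimpleGraph.card_neighborFinset_eq_degree] at h1 h2
      have := h.weight
      omega
    obtain ⟨z, hz, z', hz', hne⟩ := Finset.one_lt_card.1 h1
    simp only [Finset.mem_sdiff, mem_inner, SimpleGraph.mem_neighborFinset, and_assoc] at hz hz'
    exact ⟨z, z', hz, hz', hne⟩
  have hxz : ∀ v, v ≠ s ∧ v ≠ t ∧ ¬ G.Adj s v ∧ ¬ G.Adj t v → G.Adj x v := by
    rintro v ⟨h1, h2, h3, h4⟩
    have := hcov v h1 h2 (by rintro rfl; exact h3 hsx)
    tauto
  have hyz : ∀ v, ¬ G.Adj t v → v ≠ y := fun v hv h' => hv (h' ▸ hty)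
  by_cases hmx : m = x
  · subst hmx
    -- The second neighbour of such a `v` can only be a neighbour of `t` other than `y`. As `t` has
    -- degree at most 2, `z` and `z'` share it, which gives the forbidden detour.
    have key : ∀ v, v ≠ s ∧ v ≠ t ∧ ¬ G.Adj s v ∧ ¬ G.Adj t v →
        ∃ w, G.Adj v w ∧ G.Adj t w ∧ w ≠ y := by
      intro v hv
      have hmv := hxz v hv
      obtain ⟨w, hw, hwm⟩ := h.exists_second m hv.1 hv.2.1
      have h1 : ¬ G.Adj m w := fun h' => h.indep_move hmv h' hw
      have h2 : ¬ G.Adj s w := fun h' =>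
        h.indep_start_move hsx h' hmv hwm hv.1 hw.symm
      refine ⟨w, hw, ?_, fun h' => h1 (h' ▸ hxy)⟩
      have := hcov w (fun h' => hv.2.2.1 (h' ▸ hw).symm) (fun h' => hv.2.2.2 (h' ▸ hw).symm) hwm
      tauto
    obtain ⟨w, hw, htw, hwy⟩ := key z hz
    obtain ⟨w', hw', htw', hwy'⟩ := key z' hz'
    obtain rfl := ht3 w w' htw htw' hwy hwy'
    have := h.no_detour hsx hxy hty (hxz z hz) (hxz z' hz') hw hw' htw hwy.symm hzz
      (fun h' => h.no_common h' htw)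
    exact this.elim hz.1 hz'.1
  by_cases hsm : G.Adj s m
  -- Here `m` has two neighbours adjacent to `t` and different from `y`, so `t` has degree at least
  -- 3.
  · have key : ∀ v, G.Adj m v → v ≠ s → v ≠ t ∧ G.Adj t v ∧ v ≠ y := by
      intro v hv hvs
      have h1 : v ≠ t := by
        rintro rfl
        exact h.no_common hsm hv.symm
      have h2 : ¬ G.Adj s v := fun h' => h.indep_start hsm h' hv
      have h3 : ¬ G.Adj x v := h.indep_start_move hsm hsx hv (Ne.symm hmx) hvs
      have := hcov v hvs h1 (by rintro rfl; exact h2 hsx)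
      exact ⟨h1, by tauto, fun h' => h3 (h' ▸ hxy)⟩
    obtain ⟨p, hp, hps⟩ := h.exists_second s h.move_ne.1 h.move_ne.2
    have hp' := key p hp hps
    obtain ⟨r, hr, hrp, hrs⟩ := h.exists_third s hps hp'.1 hp
    have hr' := key r hr hrs
    exact hrp (ht3 r p hr'.2.1 hp'.2.1 hr'.2.2 hp'.2.2)
  by_cases hmy : m = y
  · subst hmy
    exact h.not_adj_of_path hty hxy.symm hsx hz.1 (hyz z hz.2.2.2) (hxz z hz)
  by_cases htm : G.Adj t m
  · have hxm : ¬ G.Adj x m := fun h' => h.symm.no_bridge hty htm (Ne.symm hmy) hxy.symm h'.symm hsx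
    have key : ∀ v, G.Adj m v → v ≠ t → v ≠ s ∧ v ≠ x ∧ ¬ G.Adj t v ∧ (G.Adj x v ∨ G.Adj s v) := by
      intro v hv hvt
      have h1 : v ≠ s := by
        rintro rfl
        exact hsm hv.symm
      have h2 : ¬ G.Adj t v := fun h' => h.indep_end htm h' hv
      have h3 : v ≠ x := by
        rintro rfl
        exact hxm hv.symm
      have := hcov v h1 hvt h3
      exact ⟨h1, h3, h2, by tauto⟩
    obtain ⟨p, hp, hpt⟩ := h.exists_second t h.move_ne.1 h.move_ne.2
    have hp' := key p hp hpt
    obtain ⟨r, hr, hrp, hrt⟩ := h.exists_third t hp'.1 hpt hp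
    have hr' := key r hr hrt
    -- The two neighbours `p`, `r` of `m` besides `t` are each adjacent to `s` or `x`. Both at `s`
    -- exceeds its degree, both at `x` is a detour, and the mixed case is excluded here.
    have two_paths : ∀ p r, G.Adj m p → G.Adj m r → p ≠ t → r ≠ t → p ≠ r → G.Adj s p →
        G.Adj x r → False := by
      intro p r hp hr hpt hrt hpr hsp hxr
      have hp' := key p hp hpt
      have hr' := key r hr hrt
      have := h.ne
      refine h.false_of_small [s, t, x, p, y, m, r] (by simp) fun G' hG => ?_
      refine forcesFirst_two_paths (x := x) (x' := p) (y := y) (y' := m) (z := r) ?_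
        (hG _ ?_ _ ?_ hsx) (hG _ ?_ _ ?_ hxy) (hG _ ?_ _ ?_ hty.symm) (hG _ ?_ _ ?_ hsp)
        (hG _ ?_ _ ?_ hp.symm) (hG _ ?_ _ ?_ htm.symm) (hG _ ?_ _ ?_ hxr) (hG _ ?_ _ ?_ hr.symm)
      · have := hsx.ne; have := hxy.ne; have := hty.ne; have := hsp.ne; have := hp.ne
        have := htm.ne; have := hxr.ne; have := hr.ne
        simp only [List.nodup_cons, List.mem_cons, not_or, List.not_mem_nil]
        grind [SimpleGraph.adj_comm]
      all_goals simp
    by_cases hsp : G.Adj s p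
    · by_cases hsr : G.Adj s r
      · exact hrp (hs3 r p hsr hsp hr'.2.1 hp'.2.1)
      · exact two_paths p r hp hr hpt hrt hrp.symm hsp (by tauto)
    · by_cases hsr : G.Adj s r
      · exact two_paths r p hr hp hrt hpt hrp hsr (by tauto)
      · have hxp : G.Adj x p := by tauto
        have hxr : G.Adj x r := by tauto
        exact (h.no_detour hsx hxy hty hxp hxr hp.symm hr.symm htm (Ne.symm hmy) hrp.symm
          hsm).elim hp'.1 hr'.1
  have hxm : G.Adj x m := hxz m ⟨h.move_ne.1, h.move_ne.2, hsm, htm⟩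
  have hxs := hsx.ne.symm
  have hxt' : x ≠ t := by
    rintro rfl
    exact hst hsx
  have key : ∀ v, G.Adj m v → v ≠ x → G.Adj s v ∨ G.Adj t v ∧ v ≠ y := by
    intro v hv hvx
    have h3 : ¬ G.Adj x v := h.indep_move hxm.symm hv
    have := hcov v (fun h' => hsm (h' ▸ hv).symm) (fun h' => htm (h' ▸ hv).symm) hvx
    by_cases hsv : G.Adj s v
    · exact .inl hsv
    · exact .inr ⟨by tauto, fun h' => h3 (h' ▸ hxy)⟩
  obtain ⟨y', hmy', hty', hyy⟩ : ∃ y', G.Adj m y' ∧ G.Adj t y' ∧ y' ≠ y := by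
    obtain ⟨p, hp, hpx, -⟩ := h.exists_third x hxs hxt' hxm.symm
    obtain ⟨r, hr, hrx, hrp⟩ := h.exists_third p hxs hxt' hxm.symm
    obtain hp' | hp' := key p hp hpx
    · obtain hr' | hr' := key r hr hrx
      · exact (hrp (hs3 r p hr' hp' hrx hpx)).elim
      · exact ⟨r, hr, hr'⟩
    · exact ⟨p, hp, hp'⟩
  obtain ⟨o, ho, hom⟩ : ∃ o, (o ≠ s ∧ o ≠ t ∧ ¬ G.Adj s o ∧ ¬ G.Adj t o) ∧ o ≠ m := by
    by_cases hzm : z = m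
    · exact ⟨z', hz', fun h' => hzz (hzm.trans h'.symm)⟩
    · exact ⟨z, hz, hzm⟩
  have hoy : o ≠ y := hyz o ho.2.2.2
  have hoy' : o ≠ y' := fun h' => ho.2.2.2 (h' ▸ hty')
  -- The edge `xo` is dispensable. When Short owns `x`, a connection reaches `t` through `y` or
  -- `y'`, and `s, x, y, t` or `s, x, m, y', t` replaces it.
  refine h.edgeMinimal.false_of_reroute h.firstMove (hxz o ho) fun A hmA hxA _ hA => .inr ?_
  have hmA' : m = s ∨ m = t ∨ m ∈ A := .inr (.inr hmA)
  obtain ⟨v, hv, hvA, -⟩ := hA.exists_last h.ne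
  have hvA : v = s ∨ v = t ∨ v ∈ A := by tauto
  have hsx' : (liveGraph (G.deleteEdges {s(x, o)}) s t A).Adj s x := by
    refine liveGraph_deleteEdges_adj hsx (.inl rfl) hxA ?_
    simp only [ne_eq, Sym2.eq_iff]
    grind
  have hvt : (liveGraph (G.deleteEdges {s(x, o)}) s t A).Adj v t := by
    refine liveGraph_deleteEdges_adj hv hvA (.inr (.inl rfl)) ?_
    simp only [ne_eq, Sym2.eq_iff]
    grind
  by_cases hvy : v = y
  · subst hvy
    refine (hsx'.reachable.trans (liveGraph_deleteEdges_adj hxy hxA hvA ?_).reachable).trans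
      hvt.reachable
    simp only [ne_eq, Sym2.eq_iff]
    grind
  · obtain rfl := ht3 v y' hv.symm hty' hvy hyy
    have := hxm.ne
    refine ((hsx'.reachable.trans (liveGraph_deleteEdges_adj hxm hxA hmA' ?_).reachable).trans
      (liveGraph_deleteEdges_adj hmy' hmA' hvA ?_).reachable).trans hvt.reachable
    all_goals
      simp only [ne_eq, Sym2.eq_iff]
      grind

end LargeMinimal

end Structure

/-! ### How the exceptional link arises -/

section Exceptional

variable {V : Type u} [Fintype V] [DecidableEq V] {G : SimpleGraph V} {s t m : V}

/-- The edges of the exceptional link occur in `G`. -/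
def ContainsExceptional (G : SimpleGraph V) (s t : V) : Prop :=
  ∃ a a' x b z z' d, [s, t, a, a', x, b, z, z', d].Nodup ∧ G.Adj s a ∧ G.Adj s a' ∧ G.Adj a x ∧
    G.Adj a' x ∧ G.Adj x b ∧ G.Adj b t ∧ G.Adj x z ∧ G.Adj x z' ∧ G.Adj z d ∧ G.Adj z' d ∧
    G.Adj d t

namespace LargeMinimal

/-- The edges of the exceptional link occur if the required adjacencies hold. -/
theorem containsExceptional (h : LargeMinimal G s t m) {a a' x b z z' d : V} (ha : G.Adj s a)
    (ha' : G.Adj s a') (haa : a ≠ a') (hxa : G.Adj x a) (hxa' : G.Adj x a') (hxs : x ≠ s)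
    (hxt : x ≠ t) (htx : ¬ G.Adj t x) (hxb : G.Adj x b) (htb : G.Adj t b) (htd : G.Adj t d)
    (hdb : d ≠ b) (hdz : G.Adj d z) (hdz' : G.Adj d z') (hxz : G.Adj x z) (hxz' : G.Adj x z')
    (hsz : ¬ G.Adj s z) (hsz' : ¬ G.Adj s z') (hzz : z ≠ z') : ContainsExceptional G s t := by
  refine ⟨a, a', x, b, z, z', d, ?_, ha, ha', hxa.symm, hxa'.symm, hxb, htb.symm, hxz, hxz',
    hdz.symm, hdz'.symm, htd.symm⟩
  have htz : ¬ G.Adj t z := fun h' => h.indep_end htd h' hdz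
  have htz' : ¬ G.Adj t z' := fun h' => h.indep_end htd h' hdz'
  have hsd : ¬ G.Adj s d := fun h' => h.no_common h' htd
  have hsb : ¬ G.Adj s b := fun h' => h.no_common h' htb
  have := ha.ne; have := ha'.ne; have := htd.ne; have := hdz.ne; have := hdz'.ne
  have := hxz.ne; have := hxz'.ne; have := htb.ne; have := hxb.ne; have := hxa.ne
  have := hxa'.ne; have := h.ne; have := h.not_adj
  clear h
  simp only [List.nodup_cons, List.mem_cons, not_or, List.not_mem_nil]
  and_intros
  all_goals grind [SimpleGraph.adj_comm]

/-- Short's win in `forcesFirst_bridge_detour_bridge` needs only two neighbours of `s`, so the edge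
to the third is dispensable. -/
theorem no_detour_bridge (h : LargeMinimal G s t m) {a a' a'' x b z d d' : V} (ha : G.Adj s a)
    (ha' : G.Adj s a') (ha'' : G.Adj s a'') (h1 : a ≠ a') (h2 : a ≠ a'') (h3 : a' ≠ a'')
    (hax : G.Adj x a) (hax' : G.Adj x a') (hxs : x ≠ s) (hxt : x ≠ t) (htx : ¬ G.Adj t x)
    (hxb : G.Adj x b) (htb : G.Adj t b) (hxz : G.Adj x z) (hsz : ¬ G.Adj s z) (hzd : G.Adj z d)
    (hzd' : G.Adj z d') (htd : G.Adj t d) (htd' : G.Adj t d') (hdb : d ≠ b) (hdb' : d' ≠ b)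
    (hdd : d ≠ d') : False := by
  have htz : ¬ G.Adj t z := fun h' => h.indep_end htd h' hzd.symm
  have hsd : ¬ G.Adj s d := fun h' => h.no_common h' htd
  have hsd' : ¬ G.Adj s d' := fun h' => h.no_common h' htd'
  have hsb : ¬ G.Adj s b := fun h' => h.no_common h' htb
  have := ha.ne; have := ha'.ne; have := htd.ne; have := htd'.ne; have := hzd.ne
  have := hzd'.ne; have := hxz.ne; have := htb.ne; have := hxb.ne; have := hax.ne
  have := hax'.ne; have := h.ne; have := h.not_adj
  refine h.edgeMinimal.2 s(s, a'') ha'' (forcesFirst_bridge_detour_bridge (a := a) (a' := a')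
    (x := x) (b := b) (z := z) (d := d) (d' := d') ?_ ?_ ?_ ?_ ?_ ?_ ?_ ?_ ?_ ?_ ?_ ?_)
  · clear h
    simp only [List.nodup_cons, List.mem_cons, not_or, List.not_mem_nil]
    and_intros
    all_goals grind [SimpleGraph.adj_comm]
  all_goals
    clear h
    simp only [SimpleGraph.deleteEdges_adj, Set.mem_singleton_iff, Sym2.eq_iff]
    grind [SimpleGraph.adj_comm]

/-- The win of `forcesFirst_threat_bridge` does not use the edge `xa`, which minimality therefore
forbids. -/
theorem no_threat_bridge (h : LargeMinimal G s t m) {a a' a'' x b z d : V} (ha : G.Adj s a)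
    (ha' : G.Adj s a') (ha'' : G.Adj s a'') (h1 : a ≠ a') (h2 : a ≠ a'') (h3 : a' ≠ a'')
    (hax : G.Adj x a) (hax' : G.Adj x a') (hax'' : G.Adj x a'') (hxs : x ≠ s) (hxt : x ≠ t)
    (htx : ¬ G.Adj t x) (hxb : G.Adj x b) (htb : G.Adj t b) (hxz : G.Adj x z) (hsz : ¬ G.Adj s z)
    (hdz : G.Adj d z) (hda : G.Adj d a) (htd : G.Adj t d) (hdb : d ≠ b) : False := by
  have htz : ¬ G.Adj t z := fun h' => h.indep_end htd h' hdz
  have hsd : ¬ G.Adj s d := fun h' => h.no_common h' htd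
  have hsb : ¬ G.Adj s b := fun h' => h.no_common h' htb
  have := ha.ne; have := ha'.ne; have := ha''.ne; have := htd.ne; have := hdz.ne
  have := hda.ne; have := hxz.ne; have := htb.ne; have := hxb.ne; have := hax.ne
  have := hax'.ne; have := hax''.ne; have := h.ne; have := h.not_adj
  refine h.edgeMinimal.2 s(x, a) hax (forcesFirst_threat_bridge (a := a) (a' := a')
    (a'' := a'') (x := x) (b := b) (z := z) (d := d) ?_ ?_ ?_ ?_ ?_ ?_ ?_ ?_ ?_ ?_ ?_ ?_)
  · clear h
    simp only [List.nodup_cons, List.mem_cons, not_or, List.not_mem_nil]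
    and_intros
    all_goals grind [SimpleGraph.adj_comm]
  all_goals
    clear h
    simp only [SimpleGraph.deleteEdges_adj, Set.mem_singleton_iff, Sym2.eq_iff]
    grind [SimpleGraph.adj_comm]

/-- A vertex that is not adjacent to a terminal violates the bound only in the exceptional link. -/
theorem containsExceptional_of_not_adj_terminal [DecidableRel G.Adj] (h : LargeMinimal G s t m)
    {x b : V} (hxs : x ≠ s) (hxt : x ≠ t) (hsx : ¬ G.Adj s x) (htx : ¬ G.Adj t x)
    (hN : ∀ a, G.Adj s a → G.Adj x a)
    (hcov : ∀ v, v ≠ s → v ≠ t → v ≠ x → G.Adj x v ∨ G.Adj t v) (hxb : G.Adj x b)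
    (htb : G.Adj t b) (hb : ∀ v, G.Adj x v → G.Adj t v → v = b)
    (hdeg : G.degree t ≤ G.degree s) : ContainsExceptional G s t := by
  by_contra hexc
  have hst := h.not_adj
  have hne := h.ne
  have hxb_ne := hxb.ne
  have htb_ne := htb.ne
  have hsb : ¬ G.Adj s b := fun h' => h.no_common h' htb
  have three : 2 < G.degree t → ∃ a, G.Adj s a ∧ ∃ a', G.Adj s a' ∧ ∃ a'', G.Adj s a'' ∧
      a ≠ a' ∧ a ≠ a'' ∧ a' ≠ a'' := by
    intro h3
    have h3 := h3.trans_le hdeg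
    rw [← SimpleGraph.card_neighborFinset_eq_degree, Finset.two_lt_card] at h3
    simpa using h3
  -- If `s` had one neighbour, so would `t`. The first move would then have to be each of them,
  -- hence a common neighbour of the terminals.
  obtain ⟨a, ha, a', ha', haa⟩ : ∃ a, G.Adj s a ∧ ∃ a', G.Adj s a' ∧ a ≠ a' := by
    by_contra! hcon
    obtain ⟨a, ha⟩ := h.exists_adj s
    have h1 : G.degree s ≤ 1 := by
      rw [← SimpleGraph.card_neighborFinset_eq_degree, Finset.card_le_one]
      simpa using hcon
    have h2 := hdeg.trans h1
    rw [← SimpleGraph.card_neighborFinset_eq_degree, Finset.card_le_one] at h2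
    have h3 := h.eq_move_of_unique fun v hv => (hcon a ha v hv).symm
    have h4 := h.symm.eq_move_of_unique (x := b) fun v hv => h2 v (by simpa) b (by simpa)
    exact hsb (h4 ▸ h3 ▸ ha)
  have no_exc : ∀ d z z', G.Adj t d → d ≠ b → G.Adj d z → G.Adj d z' → G.Adj x z → G.Adj x z' →
      ¬ G.Adj s z → ¬ G.Adj s z' → z ≠ z' → False := by
    intro d z z' htd hdb hdz hdz' hxz hxz' hsz hsz' hzz
    exact hexc (h.containsExceptional ha ha' haa (hN a ha) (hN a' ha') hxs hxt htx hxb htb htd hdb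
      hdz hdz' hxz hxz' hsz hsz' hzz)
  have no_detour_bridge : ∀ z d d', G.Adj x z → ¬ G.Adj s z → G.Adj z d → G.Adj z d' →
      G.Adj t d → G.Adj t d' → d ≠ b → d' ≠ b → d ≠ d' → False := by
    intro z d d' hxz hsz hzd hzd' htd htd' hdb hdb' hdd
    obtain ⟨a, ha, a', ha', a'', ha'', h1, h2, h3⟩ := three (by
      rw [← SimpleGraph.card_neighborFinset_eq_degree, Finset.two_lt_card]
      exact ⟨b, by simpa, d, by simpa, d', by simpa, hdb.symm, hdb'.symm, hdd⟩)
    exact h.no_detour_bridge ha ha' ha'' h1 h2 h3 (hN a ha) (hN a' ha') hxs hxt htx hxb htb hxz hsz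
      hzd hzd' htd htd' hdb hdb' hdd
  by_cases hmx : m = x
  · subst hmx
    have nbr : ∀ d y, G.Adj t d → d ≠ b → G.Adj d y → y ≠ t →
        y ≠ s ∧ y ≠ m ∧ y ≠ b ∧ G.Adj m y ∧ ¬ G.Adj t y := by
      intro d y htd hdb hdy hyt
      have h1 : y ≠ s := by
        rintro rfl
        exact h.no_common hdy.symm htd
      have h2 : ¬ G.Adj t y := fun h' => h.indep_end htd h' hdy
      have h3 : y ≠ m := by
        rintro rfl
        exact hdb (hb d hdy.symm htd)
      have := hcov y h1 hyt h3
      exact ⟨h1, h3, fun h' => h2 (h' ▸ htb), by tauto, h2⟩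
    have hright : ∀ d d' y, G.Adj t d → G.Adj t d' → d ≠ b → d' ≠ b → G.Adj d y → G.Adj d' y →
        y ≠ t → d = d' := by
      intro d d' y htd htd' hdb hdb' hdy hdy' hyt
      by_contra hdd
      by_cases hsy : G.Adj s y
      · exact h.symm.no_bridge htd htd' hdd hdy hdy' hsy
      · exact no_detour_bridge y d d' (nbr d y htd hdb hdy hyt).2.2.2.1 hsy hdy.symm hdy'.symm
          htd htd' hdb hdb' hdd
    have last : ∀ B, Joins G s t B → b ∉ B →
        ∃ d ∈ B, G.Adj t d ∧ d ≠ b ∧ ∃ y ∈ B, G.Adj d y ∧ y ≠ t := by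
      intro B hB hbB
      obtain ⟨v, hv, hvB, hw⟩ := hB.exists_last hne
      have hvs : v ≠ s := by
        rintro rfl
        exact hst hv
      obtain ⟨w, hwv, hwt, hwB⟩ := hw hvs
      have hws : w ≠ s := by
        rintro rfl
        exact h.no_common hwv hv.symm
      have hvB := hvB.resolve_left hvs
      exact ⟨v, hvB, hv.symm, fun h' => hbB (h' ▸ hvB), w, hwB.resolve_left hws, hwv.symm, hwt⟩
    -- Cut answers `x` with `b`. Now Short must reach `t` through some other neighbour `d` and a
    -- neighbour `y ≠ t` of `d`.
    have hf := h.firstMove.2.after_cut (c := b) (by simp; grind [SimpleGraph.adj_comm])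
    by_cases hmixed : ∃ d y z, G.Adj t d ∧ d ≠ b ∧ G.Adj d y ∧ G.Adj d z ∧ G.Adj s y ∧
        ¬ G.Adj s z ∧ z ≠ t
    · obtain ⟨d, y, z, htd, hdb, hdy, hdz, hsy, hsz, hzt⟩ := hmixed
      have hyt : y ≠ t := by
        rintro rfl
        exact hst hsy
      have hy := nbr d y htd hdb hdy hyt
      have hz := nbr d z htd hdb hdz hzt
      have hsd : ¬ G.Adj s d := fun h' => h.no_common h' htd
      have hyz : y ≠ z := by
        rintro rfl
        exact hsz hsy
      have hdm : d ≠ m := by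
        rintro rfl
        exact htx htd
      have hds : d ≠ s := by
        rintro rfl
        exact hst htd.symm
      by_cases h3 : ∃ p q, G.Adj s p ∧ G.Adj s q ∧ p ≠ y ∧ q ≠ y ∧ p ≠ q
      · obtain ⟨p, q, hp, hq, hpy, hqy, hpq⟩ := h3
        exact h.no_threat_bridge hsy hp hq hpy.symm hqy.symm hpq (hN y hsy) (hN p hp) (hN q hq) hxs
          hxt htx hxb htb hz.2.2.2.1 hsz hdz hdy htd hdb
      · push Not at h3
        obtain ⟨p, hp, hpy⟩ : ∃ p, G.Adj s p ∧ p ≠ y := by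
          by_cases hay : a = y
          · exact ⟨a', ha', fun h' => haa (hay.trans h'.symm)⟩
          · exact ⟨a, ha, hay⟩
        have hs2 : ∀ v, G.Adj s v → v = y ∨ v = p := by
          intro v hv
          by_contra! hcon
          exact hcon.2 (h3 v p hv hp hcon.1 hpy)
        have ht2 : ∀ v, G.Adj t v → v = b ∨ v = d := by
          intro v hv
          by_contra! hcon
          obtain ⟨a, ha, a', ha', a'', ha'', h1, h2, h3⟩ := three (by
            rw [← SimpleGraph.card_neighborFinset_eq_degree, Finset.two_lt_card]
            exact ⟨b, by simpa, d, by simpa, v, by simpa, hdb.symm, hcon.1.symm, hcon.2.symm⟩)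
          have := hs2 a ha; have := hs2 a' ha'; have := hs2 a'' ha''
          grind
        -- With `s` adjacent only to `y`, `p` and `t` only to `b`, `d`, Short must take `d`. Cut
        -- takes `y`, after which Short needs both `p` and `z`: any other usable neighbour of `d`
        -- would create a forbidden bridge or the exceptional link.
        have last' : ∀ B, Joins G s t B → b ∉ B → d ∈ B ∧ ∃ y ∈ B, G.Adj d y ∧ y ≠ t := by
          intro B hB hbB
          obtain ⟨v, hv, htv, hvb, hw⟩ := last B hB hbB
          obtain rfl := (ht2 v htv).resolve_left hvb
          exact ⟨hv, hw⟩
        have hbm := hxb.ne.symm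
        obtain hf | ⟨r, hr, hf⟩ := hf
        · have := (last' _ hf (by simpa using hbm)).1
          simp [hdm] at this
        simp only [Finset.mem_erase, mem_inner] at hr
        by_cases hrd : r = d
        · subst hrd
          have hf := hf.after_cut (c := y) (by
            simp only [Finset.mem_erase, mem_inner]
            exact ⟨hdy.ne.symm, hy.2.2.1, hy.2.1, hy.1, hyt⟩)
          have hpm := (hN p hp).ne
          have hpr : p ≠ r := by
            rintro rfl
            exact hsd hp
          refine not_forcesFirst_of_two (p := p) (q := z) (Joins.monotone _ _ _) ?_ ?_ ?_ ?_ hf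
          · simp [hpm.symm, hpr]
          · simp [hz.2.1, hdz.ne.symm]
          · rintro rfl
            exact hsz hp
          · intro B _ hB hJ
            have hbB : b ∉ B := fun hbB => by
              have := hB hbB
              simp [hbm, hdb.symm] at this
            have hyB : y ∉ B := fun hyB => by
              have := hB hyB
              simp [hy.2.1, hdy.ne.symm] at this
            constructor
            · obtain ⟨v, hv, hvB, -⟩ := (joins_comm.1 hJ).exists_last hne.symm
              obtain rfl | hvB := hvB
              · exact (hst hv.symm).elim
              · obtain rfl | rfl := hs2 v hv.symm
                · exact (hyB hvB).elim
                · exact hvB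
            · obtain ⟨-, w, hwB, hw, hwt⟩ := last' B hJ hbB
              have hwy : y ≠ w := by
                rintro rfl
                exact hyB hwB
              have hsw : ¬ G.Adj s w := fun h' =>
                h.no_bridge hsy h' hwy hdy.symm hw.symm htd
              by_contra hzB
              have hzw : z ≠ w := by
                rintro rfl
                exact hzB hwB
              exact no_exc r z w htd hdb hdz hw hz.2.2.2.1 (nbr r w htd hdb hw hwt).2.2.2.1 hsz
                hsw hzw
        · have hf := (hf.after_cut (c := d) (by
            simp only [Finset.mem_erase, mem_inner]
            exact ⟨Ne.symm hrd, hdb, hdm, hds, htd.ne.symm⟩)).win_all (Joins.monotone _ _ _)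
          have := (last' _ hf (by simp [hbm, Ne.symm hr.1])).1
          simp [hdm, Ne.symm hrd] at this
    · push Not at hmixed
      -- Each `d` has at most one neighbour besides `t`: two neighbours of `s` form a bridge, two
      -- others give the exceptional link, and mixed pairs are excluded. By `hright` the pairs form
      -- a matching.
      refine not_forcesFirst_of_matching (Joins.monotone _ _ _)
        (Q := fun d y => G.Adj t d ∧ d ≠ b ∧ G.Adj d y ∧ y ≠ t) ?_ ?_ ?_ ?_ ?_ hf
      · rintro d y y' ⟨htd, hdb, hdy, hyt⟩ ⟨-, -, hdy', hyt'⟩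
        by_contra hyy
        have hy := nbr d y htd hdb hdy hyt
        have hy' := nbr d y' htd hdb hdy' hyt'
        by_cases hsy : G.Adj s y <;> by_cases hsy' : G.Adj s y'
        · exact h.no_bridge hsy hsy' hyy hdy.symm hdy'.symm htd
        · exact hyt' (hmixed d y y' htd hdb hdy hdy' hsy hsy')
        · exact hyt (hmixed d y' y htd hdb hdy' hdy hsy' hsy)
        · exact no_exc d y y' htd hdb hdy hdy' hy.2.2.2.1 hy'.2.2.2.1 hsy hsy' hyy
      · rintro d d' y ⟨htd, hdb, hdy, hyt⟩ ⟨htd', hdb', hdy', -⟩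
        exact hright d d' y htd htd' hdb hdb' hdy hdy' hyt
      · rintro d y e ⟨htd, hdb, hdy, hyt⟩ ⟨hty, -⟩
        exact (nbr d y htd hdb hdy hyt).2.2.2.2 hty
      · intro B _ hB hJ
        obtain ⟨d, hd, htd, hdb, y, hy, hdy, hyt⟩ := last B hJ fun hbB => by
          have := hB hbB
          simp [hxb_ne.symm] at this
        exact ⟨d, hd, y, hy, htd, hdb, hdy, hyt⟩
      · rintro d y ⟨htd, hdb, hdy, hyt⟩
        refine ⟨fun hd => ?_, fun hy => ?_⟩
        · obtain rfl := Finset.mem_singleton.1 hd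
          exact (htx htd).elim
        · exact ((nbr d y htd hdb hdy hyt).2.1 (Finset.mem_singleton.1 hy)).elim
  by_cases hsm : G.Adj s m
  · have key : ∀ p, G.Adj s p → p ≠ m → False := fun p hp hpm =>
      h.indep_start_move hsm hp (hN m hsm).symm hpm hxs (hN p hp).symm
    by_cases ham : a = m
    · exact key a' ha' fun h' => haa (ham.trans h'.symm)
    · exact key a ha ham
  by_cases hmb : m = b
  · subst hmb
    obtain ⟨r, hr, hrx, hrt⟩ := h.exists_third t hxs hxt hxb.symm
    have h1 : r ≠ s := by
      rintro rfl
      exact hsm hr.symm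
    have h2 : ¬ G.Adj t r := fun h' => h.indep_end htb h' hr
    exact h.indep_move hxb.symm hr ((hcov r h1 hrt hrx).resolve_right h2)
  by_cases htm : G.Adj t m
  · have key : ∀ v, G.Adj m v → v ≠ t → v ≠ s ∧ G.Adj x v ∧ ¬ G.Adj s v := by
      intro v hv hvt
      have h1 : v ≠ s := by
        rintro rfl
        exact hsm hv.symm
      have h2 : v ≠ x := by
        rintro rfl
        exact hmb (hb m hv.symm htm)
      have h3 : ¬ G.Adj t v := fun h' => h.indep_end htm h' hv
      have h4 := (hcov v h1 hvt h2).resolve_right h3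
      exact ⟨h1, h4, fun h' => h.not_adj_of_path htm hv h' hxs (Ne.symm hmx) h4.symm⟩
    obtain ⟨p, hp, hpt⟩ := h.exists_second t h.move_ne.1 h.move_ne.2
    have hp' := key p hp hpt
    obtain ⟨r, hr, hrp, hrt⟩ := h.exists_third t hp'.1 hpt hp
    have hr' := key r hr hrt
    exact no_exc m p r htm hmb hp hr hp'.2.1 hr'.2.1 hp'.2.2 hr'.2.2 hrp.symm
  have hxm : G.Adj x m := (hcov m h.move_ne.1 h.move_ne.2 hmx).resolve_right htm
  have key : ∀ v, G.Adj m v → v ≠ x → G.Adj t v ∧ v ≠ b := by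
    intro v hv hvx
    have h1 : v ≠ s := by
      rintro rfl
      exact hsm hv.symm
    have h2 : v ≠ t := by
      rintro rfl
      exact htm hv.symm
    have h3 : ¬ G.Adj x v := h.indep_move hxm.symm hv
    exact ⟨(hcov v h1 h2 hvx).resolve_left h3, fun h' => h3 (h' ▸ hxb)⟩
  obtain ⟨p, hp, hpx, -⟩ := h.exists_third x hxs hxt hxm.symm
  obtain ⟨r, hr, hrx, hrp⟩ := h.exists_third p hxs hxt hxm.symm
  have hp' := key p hp hpx
  have hr' := key r hr hrx
  -- All neighbours of `m` except `x` are neighbours of `t` other than `b`, so `m` plays the part of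
  -- `z`.
  exact no_detour_bridge m p r hxm hsm hp hr hp'.1 hr'.1 hp'.2 hr'.2 hrp.symm

end LargeMinimal

end Exceptional

/-! ### Counting neighbourhoods -/

section Counting

variable {V : Type u} [Fintype V] [DecidableEq V] {G : SimpleGraph V} {s t m : V}
  [DecidableRel G.Adj]

namespace LargeMinimal

theorem neighborFinset_subset_inner (h : LargeMinimal G s t m) :
    G.neighborFinset s ⊆ inner s t ∧ G.neighborFinset t ⊆ inner s t := by
  have := h.not_adj
  constructor
  all_goals
    intro v hv
    rw [SimpleGraph.mem_neighborFinset] at hv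
    rw [mem_inner]
    have := hv.ne
    grind [SimpleGraph.adj_comm]

theorem disjoint_neighborFinset (h : LargeMinimal G s t m) :
    Disjoint (G.neighborFinset s) (G.neighborFinset t) := by
  rw [Finset.disjoint_left]
  intro v hv hv'
  rw [SimpleGraph.mem_neighborFinset] at hv hv'
  exact h.no_common hv hv'

/-- The terminal neighbourhoods are disjoint and, by `not_covered`, miss an inner vertex. This
settles the case of a terminal of maximum degree. -/
theorem degree_add_degree_lt (h : LargeMinimal G s t m) :
    G.degree s + G.degree t < (inner s t).card := by
  by_contra! hle
  rw [← SimpleGraph.card_neighborFinset_eq_degree, ← SimpleGraph.card_neighborFinset_eq_degree,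
    ← Finset.card_union_of_disjoint h.disjoint_neighborFinset] at hle
  have heq := Finset.eq_of_subset_of_card_le
    (Finset.union_subset h.neighborFinset_subset_inner.1 h.neighborFinset_subset_inner.2) hle
  refine h.not_covered fun v hs ht => ?_
  have : v ∈ G.neighborFinset s ∪ G.neighborFinset t := by
    rw [heq]
    simp [hs, ht]
  simpa using this

/-- The neighbours of `x`, `t` and `s`, without `s` and `x`, lie among `w - 1` vertices, and the
only overlap is between those of `x` and `t`, in at most one vertex. A violation thus gives `max
(d_s, d_t) ≤ 2`. If the maximum is 2, the overlap is nonempty and everything is covered; if it is 1,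
the first move is forced at both ends. -/
theorem bound_of_adj_terminal (h : LargeMinimal G s t m) {x : V} (hsx : G.Adj s x) :
    G.degree x + min (G.degree s) (G.degree t) < (inner s t).card := by
  by_contra! hle
  have hxt : ¬ G.Adj t x := h.no_common hsx
  have hst := h.not_adj
  have hx : x ∈ inner s t := by
    rw [mem_inner]
    exact ⟨hsx.ne.symm, by rintro rfl; exact hst hsx⟩
  have hT := Finset.card_erase_of_mem hx
  have hX : ((G.neighborFinset x).erase s).card = G.degree x - 1 := by
    rw [Finset.card_erase_of_mem (by simpa using hsx.symm),
      SimpleGraph.card_neighborFinset_eq_degree]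
  have hS : ((G.neighborFinset s).erase x).card = G.degree s - 1 := by
    rw [Finset.card_erase_of_mem (by simpa using hsx), SimpleGraph.card_neighborFinset_eq_degree]
  have hdx : 0 < G.degree x := by
    rw [SimpleGraph.degree_pos_iff_exists_adj]
    exact ⟨s, hsx.symm⟩
  have hds : 0 < G.degree s := by
    rw [SimpleGraph.degree_pos_iff_exists_adj]
    exact ⟨x, hsx⟩
  obtain ⟨b, hb⟩ := h.exists_adj t
  have hdt : 0 < G.degree t := by
    rw [SimpleGraph.degree_pos_iff_exists_adj]
    exact ⟨b, hb⟩
  have hD : ((G.neighborFinset x).erase s ∩ G.neighborFinset t).card ≤ 1 := by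
    rw [Finset.card_le_one]
    intro y hy y' hy'
    simp only [Finset.mem_inter, Finset.mem_erase, SimpleGraph.mem_neighborFinset] at hy hy'
    by_contra hyy
    exact h.symm.no_bridge hy.2 hy'.2 hyy hy.1.2.symm hy'.1.2.symm hsx
  have hP := Finset.card_union_add_card_inter ((G.neighborFinset x).erase s) (G.neighborFinset t)
  rw [hX, SimpleGraph.card_neighborFinset_eq_degree] at hP
  have hdisj : Disjoint ((G.neighborFinset x).erase s ∪ G.neighborFinset t)
      ((G.neighborFinset s).erase x) := by
    rw [Finset.disjoint_left]
    intro v hv hv'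
    simp only [Finset.mem_union, Finset.mem_erase, SimpleGraph.mem_neighborFinset] at hv hv'
    obtain hv | hv := hv
    · exact h.indep_start hsx hv'.2 hv.2
    · exact h.no_common hv'.2 hv
  have hsub : ((G.neighborFinset x).erase s ∪ G.neighborFinset t) ∪ (G.neighborFinset s).erase x ⊆
      (inner s t).erase x := by
    intro v hv
    simp only [Finset.mem_union, Finset.mem_erase, SimpleGraph.mem_neighborFinset, mem_inner]
      at hv ⊢
    have hne := h.ne
    rcases hv with (⟨h1, h2⟩ | h1) | ⟨h1, h2⟩
    · exact ⟨h2.ne.symm, h1, by rintro rfl; exact hxt h2.symm⟩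
    · exact ⟨by rintro rfl; exact hxt h1, by rintro rfl; exact hst h1.symm, h1.ne.symm⟩
    · exact ⟨h1, h2.ne.symm, by rintro rfl; exact hst h2⟩
  have hcard := Finset.card_le_card hsub
  rw [Finset.card_union_of_disjoint hdisj, hS, hT] at hcard
  have hw := h.weight
  by_cases hone : G.degree s ≤ 1 ∧ G.degree t ≤ 1
  · rw [← SimpleGraph.card_neighborFinset_eq_degree, ← SimpleGraph.card_neighborFinset_eq_degree,
      Finset.card_le_one, Finset.card_le_one] at hone
    have h1 := h.eq_move_of_unique fun v hv => hone.1 v (by simpa) x (by simpa)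
    have h2 := h.symm.eq_move_of_unique fun v hv => hone.2 v (by simpa) b (by simpa)
    exact hxt (h1 ▸ h2 ▸ hb)
  · have hmin := min_le_left (G.degree s) (G.degree t)
    have hmin' := min_le_right (G.degree s) (G.degree t)
    obtain ⟨y, hy⟩ : ((G.neighborFinset x).erase s ∩ G.neighborFinset t).Nonempty := by
      rw [← Finset.card_pos]
      omega
    simp only [Finset.mem_inter, Finset.mem_erase, SimpleGraph.mem_neighborFinset] at hy
    have heq := Finset.eq_of_subset_of_card_le hsub (by
      rw [Finset.card_union_of_disjoint hdisj, hS, hT]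
      omega)
    refine h.false_of_adj_terminal hsx hy.1.2 hy.2 ?_ (by omega) (by omega)
    intro v h1 h2 h3
    have : v ∈ (inner s t).erase x := by simp [h1, h2, h3]
    rw [← heq] at this
    simp only [Finset.mem_union, Finset.mem_erase, SimpleGraph.mem_neighborFinset] at this
    tauto

/-- The case in which `x` and `t` have at most one common neighbour. -/
theorem containsExceptional_of_card_inter_le (h : LargeMinimal G s t m) {x : V} (hxs : x ≠ s)
    (hxt : x ≠ t) (hsx : ¬ G.Adj s x) (htx : ¬ G.Adj t x)
    (hs : (inner s t).card ≤ G.degree x + G.degree s)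
    (ht : (inner s t).card ≤ G.degree x + G.degree t)
    (hD : (G.neighborFinset x ∩ G.neighborFinset t).card ≤ 1) : ContainsExceptional G s t := by
  have hT := Finset.card_erase_of_mem (show x ∈ inner s t by simp [hxs, hxt])
  have hP := Finset.card_union_add_card_inter (G.neighborFinset x) (G.neighborFinset t)
  rw [SimpleGraph.card_neighborFinset_eq_degree, SimpleGraph.card_neighborFinset_eq_degree] at hP
  have hsub : G.neighborFinset x ∪ G.neighborFinset t ⊆ (inner s t).erase x := by
    intro v hv
    have hst := h.not_adj
    simp only [Finset.mem_union, Finset.mem_erase, SimpleGraph.mem_neighborFinset, mem_inner]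
      at hv ⊢
    rcases hv with h1 | h1
    · exact ⟨h1.ne.symm, by rintro rfl; exact hsx h1.symm, by rintro rfl; exact htx h1.symm⟩
    · exact ⟨by rintro rfl; exact htx h1, by rintro rfl; exact hst h1.symm, h1.ne.symm⟩
  have hcard := Finset.card_le_card hsub
  have hw := h.weight
  rw [hT] at hcard
  -- The union has size at most `w - 1` and the overlap at most 1, while the degrees sum to at least
  -- `w`; so both bounds are attained and `d_x + d_t = w`, whence also `d_t ≤ d_s`.
  have heq := Finset.eq_of_subset_of_card_le hsub (by omega)
  have hcov : ∀ v, v ≠ s → v ≠ t → v ≠ x → G.Adj x v ∨ G.Adj t v := by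
    intro v h1 h2 h3
    have : v ∈ (inner s t).erase x := by simp [h1, h2, h3]
    rw [← heq] at this
    simpa using this
  obtain ⟨b, hb⟩ : (G.neighborFinset x ∩ G.neighborFinset t).Nonempty := by
    rw [← Finset.card_pos]
    omega
  have hdeg : G.degree t ≤ G.degree s := by omega
  rw [Finset.card_le_one] at hD
  have hb' := hb
  simp only [Finset.mem_inter, SimpleGraph.mem_neighborFinset] at hb'
  refine h.containsExceptional_of_not_adj_terminal hxs hxt hsx htx (fun a ha => ?_) hcov hb'.1
    hb'.2 (fun v h1 h2 => hD v (by simp [h1, h2]) b hb) hdeg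
  refine (hcov a ha.ne.symm ?_ ?_).resolve_right (h.no_common ha)
  · rintro rfl
    exact h.not_adj ha
  · rintro rfl
    exact hsx ha

theorem containsExceptional_of_le (h : LargeMinimal G s t m) (x : V)
    (hs : (inner s t).card ≤ G.degree x + G.degree s)
    (ht : (inner s t).card ≤ G.degree x + G.degree t) :
    ContainsExceptional G s t ∨ ContainsExceptional G t s := by
  have hlt := h.degree_add_degree_lt
  by_cases hxs : x = s
  · subst hxs
    omega
  by_cases hxt : x = t
  · subst hxt
    omega
  have hsx : ¬ G.Adj s x := fun hsx => by
    have := h.bound_of_adj_terminal hsx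
    omega
  have htx : ¬ G.Adj t x := fun htx => by
    have := h.symm.bound_of_adj_terminal htx
    rw [inner_comm] at this
    omega
  by_cases hD : (G.neighborFinset x ∩ G.neighborFinset t).card ≤ 1
  · exact .inl (h.containsExceptional_of_card_inter_le hxs hxt hsx htx hs ht hD)
  by_cases hC : (G.neighborFinset x ∩ G.neighborFinset s).card ≤ 1
  · refine .inr (h.symm.containsExceptional_of_card_inter_le hxt hxs htx hsx ?_ ?_ hC)
    all_goals rwa [inner_comm]
  exfalso
  rw [not_le, Finset.one_lt_card] at hC hD
  obtain ⟨a, ha, a', ha', haa⟩ := hC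
  obtain ⟨b, hb, b', hb', hbb⟩ := hD
  simp only [Finset.mem_inter, SimpleGraph.mem_neighborFinset] at ha ha' hb hb'
  have hne := h.ne
  have hst := h.not_adj
  have h1 : ∀ a, G.Adj x a ∧ G.Adj s a → ∀ b, G.Adj x b ∧ G.Adj t b → a ≠ b := by
    rintro a ha b hb rfl
    exact h.no_common ha.2 hb.2
  have hab := h1 a ha b hb
  have hab' := h1 a ha b' hb'
  have ha'b := h1 a' ha' b hb
  have ha'b' := h1 a' ha' b' hb'
  refine h.false_of_small [s, t, a, a', x, b, b'] (by simp) fun G' hG => ?_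
  refine forcesFirst_bridge_bridge (a := a) (a' := a') (x := x) (b := b) (b' := b') ?_
    (hG _ ?_ _ ?_ ha.2) (hG _ ?_ _ ?_ ha'.2) (hG _ ?_ _ ?_ ha.1.symm) (hG _ ?_ _ ?_ ha'.1.symm)
    (hG _ ?_ _ ?_ hb.1) (hG _ ?_ _ ?_ hb'.1) (hG _ ?_ _ ?_ hb.2.symm) (hG _ ?_ _ ?_ hb'.2.symm)
  · have := ha.1.ne; have := ha.2.ne; have := ha'.1.ne; have := ha'.2.ne
    have := hb.1.ne; have := hb.2.ne; have := hb'.1.ne; have := hb'.2.ne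
    clear h hG h1 hlt
    simp only [List.nodup_cons, List.mem_cons, not_or, List.not_mem_nil]
    and_intros
    all_goals grind [SimpleGraph.adj_comm]
  all_goals simp

end LargeMinimal

end Counting

/-! ### Uniqueness and verification of the exceptional link -/

section ExceptionalLink

/-- An edge outside the embedded copy could be deleted without harming Short's strategy there. As
every vertex lies on an edge, the copy is also spanning. -/
theorem ContainsExceptional.exists_iso {V : Type u} [Fintype V] [DecidableEq V]
    {G : SimpleGraph V} {s t : V} (hc : ContainsExceptional G s t) (h : EdgeMinimal G s t)
    (hadj : ∀ v, ∃ w, G.Adj v w) :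
    ∃ φ : G ≃g exceptionalLink.graph, φ s = exceptionalLink.s ∧ φ t = exceptionalLink.t := by
  obtain ⟨a, a', x, b, z, z', d, hn, h1, h2, h3, h4, h5, h6, h7, h8, h9, h10, h11⟩ := hc
  set f : Fin 9 → V := ![s, t, a, a', x, b, z, z', d] with hf
  have hinj : Function.Injective f := by
    rw [← List.nodup_ofFn]
    simpa [hf, List.ofFn_succ] using hn
  have hedge : ∀ e ∈ G.edgeSet, ∃ e' ∈ exceptionalEdges, Sym2.map f e' = e := by
    intro e he
    by_contra! hcon
    have key : ∀ i j : Fin 9, s(i, j) ∈ exceptionalEdges → G.Adj (f i) (f j) →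
        (G.deleteEdges {e}).Adj (f i) (f j) := by
      intro i j hij hG
      rw [SimpleGraph.deleteEdges_adj]
      exact ⟨hG, hcon s(i, j) hij⟩
    exact h.2 e he (forcesFirst_bridge_detour hn (key 0 2 (by decide) h1) (key 0 3 (by decide) h2)
      (key 2 4 (by decide) h3) (key 3 4 (by decide) h4) (key 4 5 (by decide) h5)
      (key 5 1 (by decide) h6) (key 4 6 (by decide) h7) (key 4 7 (by decide) h8)
      (key 6 8 (by decide) h9) (key 7 8 (by decide) h10) (key 8 1 (by decide) h11))
  have hsurj : Function.Surjective f := by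
    intro v
    obtain ⟨w, hw⟩ := hadj v
    obtain ⟨e', -, he'⟩ := hedge s(v, w) hw
    have : v ∈ Sym2.map f e' := by
      rw [he']
      exact Sym2.mem_mk_left v w
    obtain ⟨i, -, hi⟩ := Sym2.mem_map.1 this
    exact ⟨i, hi⟩
  have hmem : ∀ e ∈ exceptionalEdges, Sym2.map f e ∈ G.edgeSet := by
    intro e he
    simp only [exceptionalEdges, Finset.mem_insert, Finset.mem_singleton] at he
    rcases he with rfl | rfl | rfl | rfl | rfl | rfl | rfl | rfl | rfl | rfl | rfl
    all_goals assumption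
  let φ : exceptionalLink.graph ≃g G :=
    { toEquiv := Equiv.ofBijective f ⟨hinj, hsurj⟩
      map_rel_iff' := by
        intro i j
        change G.Adj (f i) (f j) ↔ exceptionalLink.graph.Adj i j
        simp only [exceptionalLink, SimpleGraph.fromEdgeSet_adj, Finset.mem_coe]
        constructor
        · intro hij
          obtain ⟨e', he', heq⟩ := hedge s(f i, f j) hij
          rw [← Sym2.map_mk, (Sym2.map.injective hinj).eq_iff] at heq
          exact ⟨heq ▸ he', fun hij' => hij.ne (congrArg f hij')⟩
        · rintro ⟨hij, -⟩
          exact hmem _ hij }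
  refine ⟨φ.symm, ?_, ?_⟩
  · exact φ.symm_apply_eq.2 rfl
  · exact φ.symm_apply_eq.2 rfl

/-- `S` separates `0` from `1`, and every edge of `E` that leaves `S` meets `P`. -/
def IsCut (E : Finset (Sym2 (Fin 9))) (S P : Finset (Fin 9)) : Prop :=
  (0 ∈ S ∧ 1 ∉ S) ∧ (0 ∉ P ∧ 1 ∉ P) ∧ ∀ u ∈ S, ∀ v, v ∉ S → s(u, v) ∈ E → u ∈ P ∨ v ∈ P

instance decidableIsCut (E : Finset (Sym2 (Fin 9))) (S P : Finset (Fin 9)) :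
    Decidable (IsCut E S P) := by
  unfold IsCut
  infer_instance

theorem Joins.exists_mem_of_cut {G : SimpleGraph (Fin 9)} {B : Finset (Fin 9)}
    (h : Joins G 0 1 B) {E : Finset (Sym2 (Fin 9))} (hG : ∀ u v, G.Adj u v → s(u, v) ∈ E)
    (S P : Finset (Fin 9)) (hcut : IsCut E S P) : ∃ p ∈ P, p ∈ B := by
  obtain ⟨hS, hP, hcut⟩ := hcut
  obtain ⟨γ⟩ := h
  obtain ⟨d, -, hd1, hd2⟩ := γ.exists_boundary_dart (S : Set (Fin 9)) hS.1 hS.2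
  have hd := d.adj
  obtain h' | h' := hcut _ hd1 _ hd2 (hG _ _ hd.1)
  · exact ⟨_, h', (hd.2.1.resolve_left fun h0 => hP.1 (h0 ▸ h')).resolve_left
      fun h0 => hP.2 (h0 ▸ h')⟩
  · exact ⟨_, h', (hd.2.2.resolve_left fun h0 => hP.1 (h0 ▸ h')).resolve_left
      fun h0 => hP.2 (h0 ▸ h')⟩

theorem not_forcesFirst_of_cuts {G : SimpleGraph (Fin 9)} {E : Finset (Sym2 (Fin 9))}
    (hG : ∀ u v, G.Adj u v → s(u, v) ∈ E) (S S' : Finset (Fin 9)) {p q : Fin 9} (hpq : p ≠ q)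
    (hcut : IsCut E S {p}) (hcut' : IsCut E S' {q}) :
    ¬ ForcesFirst (Joins G 0 1) ∅ (inner 0 1) := by
  refine not_forcesFirst_of_two (p := p) (q := q) (Joins.monotone _ _ _) (by simp) (by simp) hpq ?_
  intro B _ _ hB
  have h1 := hB.exists_mem_of_cut hG S {p} hcut
  have h2 := hB.exists_mem_of_cut hG S' {q} hcut'
  simpa using And.intro h1 h2

/-- Short must open with the cut vertex `4`, and Cut answers `5`. The two remaining cuts then make
both `8` and `p` necessary, and Cut takes one of them. -/
theorem not_forcesFirst_of_detour_cuts {G : SimpleGraph (Fin 9)} {E : Finset (Sym2 (Fin 9))}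
    (hG : ∀ u v, G.Adj u v → s(u, v) ∈ E) (S S' S'' : Finset (Fin 9)) {p : Fin 9}
    (hp : 8 ≠ p ∧ p ≠ 4) (hcut : IsCut E S {4}) (hcut' : IsCut E S' {5, 8})
    (hcut'' : IsCut E S'' {5, p}) :
    ¬ ForcesFirst (Joins G 0 1) ∅ (inner 0 1) := by
  have h4 : ∀ B, Joins G 0 1 B → 4 ∈ B := fun B hB => by
    simpa using hB.exists_mem_of_cut hG S {4} hcut
  rintro (hf | ⟨r, hr, hf⟩)
  · simpa using h4 _ hf
  by_cases hr4 : r = 4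
  · subst hr4
    refine not_forcesFirst_of_two (p := 8) (q := p) (Joins.monotone _ _ _) (by decide)
      (by simpa using hp.2) hp.1 ?_ (hf.after_cut (c := 5) (by decide))
    intro B _ hBF hB
    have h5 : 5 ∉ B := fun h5 => absurd (hBF h5) (by decide)
    have h1 := hB.exists_mem_of_cut hG S' {5, 8} hcut'
    have h2 := hB.exists_mem_of_cut hG S'' {5, p} hcut''
    simp only [Finset.mem_insert, Finset.mem_singleton, exists_eq_or_imp, exists_eq_left, h5,
      false_or] at h1 h2
    exact ⟨h1, h2⟩
  · have := h4 _ ((hf.after_cut (c := 4) (by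
      simp only [Finset.mem_erase, mem_inner]
      exact ⟨Ne.symm hr4, by decide⟩)).win_all (Joins.monotone _ _ _))
    simp [Ne.symm hr4] at this

theorem exceptionalLink_adj {u v : Fin 9} :
    exceptionalLink.graph.Adj u v ↔ s(u, v) ∈ exceptionalEdges ∧ u ≠ v := by
  simp [exceptionalLink, SimpleGraph.fromEdgeSet_adj]

theorem edgeMinimal_exceptionalLink : EdgeMinimal exceptionalLink.graph 0 1 := by
  have adj : ∀ i j : Fin 9, s(i, j) ∈ exceptionalEdges ∧ i ≠ j → exceptionalLink.graph.Adj i j :=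
    fun i j => exceptionalLink_adj.2
  refine ⟨forcesFirst_bridge_detour (a := 2) (a' := 3) (x := 4) (b := 5) (z := 6) (z' := 7)
    (d := 8) (by decide) ?_ ?_ ?_ ?_ ?_ ?_ ?_ ?_ ?_ ?_ ?_, fun e he => ?_⟩
  iterate 11 exact adj _ _ (by decide)
  have hG : ∀ u v, (exceptionalLink.graph.deleteEdges {e}).Adj u v →
      s(u, v) ∈ exceptionalEdges.erase e := by
    intro u v huv
    rw [SimpleGraph.deleteEdges_adj] at huv
    exact Finset.mem_erase.2 ⟨huv.2, (exceptionalLink_adj.1 huv.1).1⟩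
  have he' : e ∈ exceptionalEdges := by
    induction e with
    | _ u v => exact (exceptionalLink_adj.1 he).1
  clear he
  simp only [exceptionalEdges, Finset.mem_insert, Finset.mem_singleton] at he'
  -- Deleting an edge of the bridge from `0` to `4`, or of the paths `4, 5, 1` and `8, 1`, creates a
  -- second cut vertex besides `4`. Deleting one of the four edges between `4` and `8` leaves only
  -- one of `6`, `7` usable, so the cuts with the detour apply.
  rcases he' with rfl | rfl | rfl | rfl | rfl | rfl | rfl | rfl | rfl | rfl | rfl
  · exact not_forcesFirst_of_cuts hG {0, 2, 3} {0} (p := 4) (q := 3)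
      (by decide) (by decide) (by decide)
  · exact not_forcesFirst_of_cuts hG {0, 2, 3} {0} (p := 4) (q := 2)
      (by decide) (by decide) (by decide)
  · exact not_forcesFirst_of_cuts hG {0, 2, 3} {0, 2} (p := 4) (q := 3)
      (by decide) (by decide) (by decide)
  · exact not_forcesFirst_of_cuts hG {0, 2, 3} {0, 3} (p := 4) (q := 2)
      (by decide) (by decide) (by decide)
  · exact not_forcesFirst_of_cuts hG {0, 2, 3} {0, 2, 3, 4, 6, 7} (p := 4) (q := 8)
      (by decide) (by decide) (by decide)
  · exact not_forcesFirst_of_cuts hG {0, 2, 3} {0, 2, 3, 4, 5, 6, 7} (p := 4) (q := 8)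
      (by decide) (by decide) (by decide)
  · exact not_forcesFirst_of_detour_cuts hG {0, 2, 3} {0, 2, 3, 4, 6, 7} {0, 2, 3, 4} (p := 7)
      (by decide) (by decide) (by decide) (by decide)
  · exact not_forcesFirst_of_detour_cuts hG {0, 2, 3} {0, 2, 3, 4, 6, 7} {0, 2, 3, 4} (p := 6)
      (by decide) (by decide) (by decide) (by decide)
  · exact not_forcesFirst_of_detour_cuts hG {0, 2, 3} {0, 2, 3, 4, 6, 7} {0, 2, 3, 4, 6} (p := 7)
      (by decide) (by decide) (by decide) (by decide)
  · exact not_forcesFirst_of_detour_cuts hG {0, 2, 3} {0, 2, 3, 4, 6, 7} {0, 2, 3, 4, 7} (p := 6)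
      (by decide) (by decide) (by decide) (by decide)
  · exact not_forcesFirst_of_cuts hG {0, 2, 3} {0, 2, 3, 4, 6, 7, 8} (p := 4) (q := 5)
      (by decide) (by decide) (by decide)

theorem not_isStrongLink_exceptionalLink : ¬ exceptionalLink.IsStrongLink := by
  intro h
  have hf : Forces (Joins exceptionalLink.graph 0 1) ∅ (inner 0 1) :=
    (winsSecond_short_iff exceptionalLink).1 h
  -- Cut moves first and takes the cut vertex `4`.
  have hJ := (hf.after_cut (c := 4) (by decide)).win_all (Joins.monotone _ _ _)
  have := hJ.exists_mem_of_cut (E := exceptionalEdges) (fun u v h => (exceptionalLink_adj.1 h).1)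
    {0, 2, 3} {4} (by decide)
  simp at this

theorem connected_exceptionalLink : exceptionalLink.graph.Connected := by
  have adj : ∀ i j : Fin 9, s(i, j) ∈ exceptionalEdges ∧ i ≠ j →
      exceptionalLink.graph.Reachable i j := fun i j h => (exceptionalLink_adj.2 h).reachable
  rw [SimpleGraph.connected_iff_exists_forall_reachable]
  refine ⟨4, fun v => ?_⟩
  fin_cases v
  · exact (adj 4 2 (by decide)).trans (adj 2 0 (by decide))
  · exact (adj 4 5 (by decide)).trans (adj 5 1 (by decide))
  · exact adj 4 2 (by decide)
  · exact adj 4 3 (by decide)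
  · exact .refl _
  · exact adj 4 5 (by decide)
  · exact adj 4 6 (by decide)
  · exact adj 4 7 (by decide)
  · exact (adj 4 6 (by decide)).trans (adj 6 8 (by decide))

theorem not_degreeBound_exceptionalLink : ¬ exceptionalLink.DegreeBound := by
  intro h
  have h4 := exceptionalLink.graph.degree_le_maxDegree 4
  have h5 : exceptionalLink.graph.degree 4 = 5 := by decide
  have h0 : exceptionalLink.graph.degree exceptionalLink.s = 2 := by decide
  have h1 : exceptionalLink.graph.degree exceptionalLink.t = 2 := by decide
  have hw : exceptionalLink.weight = 7 := by decide
  rw [DegreeBound, h0, h1, hw] at h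
  omega

end ExceptionalLink

end ShannonGame

theorem mainTheorem4 :
    (∀ (V : Type u) [Fintype V] [DecidableEq V] (L : ShannonGame V)
        [DecidableRel L.graph.Adj], L.graph.Connected → L.IsMinimalWeakLink → 5 < L.weight →
        L.DegreeBound ∨ L.Isomorphic ShannonGame.exceptionalLink) ∧
      (ShannonGame.exceptionalLink.graph.Connected ∧
        ShannonGame.exceptionalLink.IsMinimalWeakLink ∧
        ShannonGame.exceptionalLink.weight = 7 ∧
        ¬ ShannonGame.exceptionalLink.DegreeBound) := by
  refine ⟨?_, ShannonGame.connected_exceptionalLink,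
    ShannonGame.edgeMinimal_exceptionalLink.isMinimalWeakLink
      ShannonGame.not_isStrongLink_exceptionalLink, by decide,
    ShannonGame.not_degreeBound_exceptionalLink⟩
  intro V _ _ L _ hconn hmin hw
  have hw' : 5 < (ShannonGame.inner L.s L.t).card := hw
  have hE := hmin.edgeMinimal
  obtain ⟨m, hm⟩ := hE.exists_firstMove (Finset.card_pos.1 (by omega))
  have h : ShannonGame.LargeMinimal L.graph L.s L.t m := ⟨L.s_ne_t, hE, hconn, hw', hm⟩
  rw [or_iff_not_imp_left]
  intro hbound
  have : Nonempty V := ⟨L.s⟩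
  obtain ⟨x, hx⟩ := L.graph.exists_maximal_degree_vertex
  have hbound : ¬ L.graph.degree x + min (L.graph.degree L.s) (L.graph.degree L.t) ≤
      (ShannonGame.inner L.s L.t).card - 1 := by
    rw [← hx]
    exact hbound
  -- As `w > 5`, the subtraction in the bound is genuine, and its failure bounds `d_x` plus either
  -- terminal degree below by `w`.
  obtain hc | hc := h.containsExceptional_of_le x (by omega) (by omega)
  · obtain ⟨φ, h1, h2⟩ := hc.exists_iso hE h.exists_adj
    exact ⟨φ, .inl ⟨h1, h2⟩⟩
  · obtain ⟨φ, h1, h2⟩ := hc.exists_iso hE.symm h.exists_adj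
    exact ⟨φ, .inr ⟨h2, h1⟩⟩
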